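/- Conventions. A small category $\Lambda$ is identified with its set of morphisms; $\mathbf s,\mathbf t$ are source and target, $\Lambda^{(0)}$ is the set of objects (identified with the units), and $fg$ is defined iff $\mathbf s(f)=\mathbf t(g)$, written $(f,g)\in\Lambda^{(2)}$. Write $f\perp g$ if there are no $k,l\in\Lambda$ with $fk=gl$. A representation of $\Lambda$ in a $C^*$-algebra $B$ is a map $S:\Lambda\to B$ such that each $S_f$ is a partial isometry; $S_fS_g=S_{fg}$ if $(f,g)\in\Lambda^{(2)}$ and $S_fS_g=0$ otherwise; the projections $Q_f=S_f^*S_f$ and $P_g=S_gS_g^*$ ($f,g\in\Lambda$) all commute; $P_fP_g=0$ if $f\perp g$; and $Q_fP_g=P_g$ if $(f,g)\in\Lambda^{(2)}$. $C^*(\Lambda)$ is the universal (not necessarily unital) $C^*$-algebra generated by a representation $\{S_f\}_{f\in\Lambda}$ of $\Lambda$. A left action $(\varphi,\alpha)$ of a groupoid $G$ on a small category $H$ consists of a surjection $\varphi:H^{(0)}\to G^{(0)}$ and elements $\alpha_g(h)\in H$, defined for $g\in G$ and $h\in H^g:=\{h\in H:\mathbf s(g)=\varphi(\mathbf s(h))=\varphi(\mathbf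 t(h))\}$, such that $\alpha_g(\mathbf s(h))=\mathbf s(\alpha_g(h))$, $\alpha_g(\mathbf t(h))=\mathbf t(\alpha_g(h))$, $\varphi(\alpha_g(u))=\mathbf t(g)$ for units $u$, $\alpha_{\varphi(\mathbf t(h))}(h)=h$, $\alpha_{g'}(\alpha_g(h))=\alpha_{g'g}(h)$ and $\alpha_g(h'h)=\alpha_g(h')\alpha_g(h)$ whenever these make sense. It is regular if $\varphi(\mathbf s(h))=\varphi(\mathbf t(h))$ for all $h\in H$. A quasi-action $\beta$ of $G$ on a $C^*$-algebra $A$ assigns to each $g\in G$ a $*$-homomorphism $\beta_g:A\to A$ and a closed $*$-subalgebra $\mathcal D(\beta_g)\subseteq A$ which $\beta_g$ maps bijectively onto $\beta_g(A)$, such that $\beta_t(A)=\mathcal D(\beta_s)$, $\mathcal D(\beta_{st})=\mathcal D(\beta_t)$ and $\beta_{st}=\beta_s\beta_t$ if $(s,t)\in G^{(2)}$, and $\beta_s\beta_t=0$ otherwise. Let $A[G]$ be the $*$-algebra of finite sums $\sum_{t\in G}a_t t$ with $a_t\in\mathcal D(\beta_{t^{-1}})$, with $(at)(bv)=a\beta_t(b)\,tv$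 if $(t,v)\in G^{(2)}$, $(at)(bv)=0$ otherwise, and $(at)^*=\beta_{t^{-1}}(a^*)\,t^{-1}$. The crossed product $A\times_\beta G$ is the completion of $A[G]$ in the norm $\|f\|=\sup_\sigma\|\sigma(f)\|$, where $\sigma$ runs over the $*$-representations of $A[G]$ on Hilbert spaces with $\|\sigma(\sum a_tt)\|\le\sum\|a_t\|$. A regular action $\alpha$ of $G$ on $H$ gives a quasi-action $\tilde\alpha$ of $G$ on $C^*(H)$: $\tilde\alpha_g(S_h)=S_{\alpha_g(h)}$ if $h\in H^g$, $\tilde\alpha_g(S_h)=0$ if $h\notin H^g$, and $\mathcal D(\tilde\alpha_g)$ is the closed $*$-subalgebra generated by $\{S_h:h\in H^g\}$. A group bundle $(X,R,\{\Gamma_\xi\}_{\xi\in X/R})$ is a set $X$ with an equivalence relation $R$ and a group $\Gamma_\xi$ for each class $\xi$. Its groupoid has unit space $X$ and consists of the triples $(x,\gamma,y)$ with $x,y\in\xi$, $\gamma\in\Gamma_\xi$, $\xi\in X/R$, with target $x$, source $y$ and $(x,\gamma,y)(y,\delta,z)=(x,\gamma\delta,z)$. Theorem. Let $\alpha$ be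 a regular action of a groupoid $G$ on a small category $H$, with map $\varphi:H^{(0)}\to G^{(0)}$. Let $G$ be isomorphic to the groupoid of a group bundle $(X,R,\{\Gamma_\xi\}_{\xi\in X/R})$, and identify $G^{(0)}$ with $X$ by the isomorphism. For $\xi\in X/R$ let $G_\xi=\{g\in G:\mathbf s(g),\mathbf t(g)\in\xi\}$, let $H_\xi=\{h\in H:\varphi(\mathbf s(h))\in\xi\}$, and let $\alpha_\xi$ be the (regular) action of the groupoid $G_\xi$ on $H_\xi$ inherited from $\alpha$. Then there is a $*$-isomorphism $$C^*(H)\times_{\tilde\alpha}G\;\cong\;\bigoplus_{\xi\in X/R}^{c_0}C^*(H_\xi)\times_{\tilde\alpha_\xi}G_\xi ,$$ where the $c_0$-direct sum consists of the families $(a_\xi)$ such that for each $\varepsilon>0$ one has $\|a_\xi\|<\varepsilon$ for all $\xi$ outside of some finite set. -/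

import Mathlib

open CategoryTheory UniformSpace
open scoped CStarAlgebra

universe u

set_option linter.unusedSectionVars false

noncomputable section

/-! ### C*-seminorms and the completion of a *-algebra in a C*-seminorm -/

section Completion

/-- A C*-seminorm on a (not necessarily unital) complex *-algebra. -/
structure IsCStarSeminorm {A : Type u} [NonUnitalRing A] [StarRing A] [Module ℂ A]
    (p : A → ℝ) : Prop where
  map_zero : p 0 = 0
  add_le : ∀ a b, p (a + b) ≤ p a + p b
  map_smul : ∀ (c : ℂ) a, p (c • a) = ‖c‖ * p a
  mul_le : ∀ a b, p (a * b) ≤ p a * p b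
  map_star : ∀ a, p (star a) = p a
  cstar : ∀ a, p (star a * a) = p a * p a

/-- The norm of the image under a *-homomorphism into a C*-algebra is a C*-seminorm. -/
theorem IsCStarSeminorm.ofHom {A : Type u} [NonUnitalRing A] [StarRing A] [Module ℂ A]
    {B : Type u} [NonUnitalCStarAlgebra B] (π : A →⋆ₙₐ[ℂ] B) :
    IsCStarSeminorm fun a => ‖π a‖ where
  map_zero := by simp
  add_le a b := by simpa using norm_add_le (π a) (π b)
  map_smul c a := by simp [norm_smul]
  mul_le a b := by simpa using norm_mul_le (π a) (π b)
  map_star a := by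
    rw [StarHomClass.map_star, norm_star]
  cstar a := by
    rw [_root_.map_mul, StarHomClass.map_star, CStarRing.norm_star_mul_self]

theorem IsCStarSeminorm.nonneg {A : Type u} [NonUnitalRing A] [StarRing A] [Module ℂ A]
    {p : A → ℝ} (hp : IsCStarSeminorm p) (a : A) : 0 ≤ p a := by
  have h := hp.add_le a ((-1 : ℂ) • a)
  rw [hp.map_smul] at h
  have h0 : a + (-1 : ℂ) • a = 0 := by simp
  rw [h0, hp.map_zero] at h
  simp at h
  linarith

/-- The pointwise supremum of a nonempty, pointwise bounded family of C*-seminorms is a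
C*-seminorm. -/
theorem IsCStarSeminorm.iSup {A : Type u} [NonUnitalRing A] [StarRing A] [Module ℂ A]
    {P : Set (A → ℝ)} (hne : P.Nonempty) (hP : ∀ p ∈ P, IsCStarSeminorm p)
    (hb : ∀ a, ∃ C, ∀ p ∈ P, p a ≤ C) : IsCStarSeminorm fun a => ⨆ p : P, p.1 a := by
  have : Nonempty P := hne.to_subtype
  have hbdd : ∀ a, BddAbove (Set.range fun p : P => p.1 a) := fun a => by
    obtain ⟨C, hC⟩ := hb a
    exact ⟨C, by rintro _ ⟨p, rfl⟩; exact hC p.1 p.2⟩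
  have hle : ∀ a (p : P), p.1 a ≤ ⨆ p : P, p.1 a := fun a p => le_ciSup (hbdd a) p
  have hn : ∀ a, 0 ≤ ⨆ p : P, p.1 a := fun a =>
    Real.iSup_nonneg fun p => (hP p.1 p.2).nonneg a
  refine ⟨?_, ?_, ?_, ?_, ?_, ?_⟩
  · simp [fun p : P => (hP p.1 p.2).map_zero]
  · exact fun a b => ciSup_le fun p =>
      ((hP p.1 p.2).add_le a b).trans (add_le_add (hle a p) (hle b p))
  · intro c a
    rw [Real.mul_iSup_of_nonneg (norm_nonneg c)]
    exact iSup_congr fun p => (hP p.1 p.2).map_smul c a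
  · exact fun a b => ciSup_le fun p => ((hP p.1 p.2).mul_le a b).trans
      (mul_le_mul (hle a p) (hle b p) ((hP p.1 p.2).nonneg b) (hn a))
  · exact fun a => iSup_congr fun p => (hP p.1 p.2).map_star a
  · intro a
    apply le_antisymm
    · exact ciSup_le fun p => ((hP p.1 p.2).cstar a).le.trans
        (mul_self_le_mul_self ((hP p.1 p.2).nonneg a) (hle a p))
    · have h : ∀ p : P, p.1 a ≤ Real.sqrt (⨆ p : P, p.1 (star a * a)) := fun p => by
        apply Real.le_sqrt_of_sq_le
        rw [sq, ← (hP p.1 p.2).cstar a]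
        exact hle (star a * a) p
      calc (⨆ p : P, p.1 a) * (⨆ p : P, p.1 a)
          ≤ Real.sqrt (⨆ p : P, p.1 (star a * a)) * Real.sqrt (⨆ p : P, p.1 (star a * a)) :=
            mul_self_le_mul_self (hn a) (ciSup_le h)
        _ = _ := Real.mul_self_sqrt (hn _)

variable {A : Type u} [NonUnitalRing A] [StarRing A] [Module ℂ A] [IsScalarTower ℂ A A]
  [SMulCommClass ℂ A A] [StarModule ℂ A]

/-- The *-algebra `A`, regarded as a seminormed space with the C*-seminorm `p`. -/
def SeminormedCopy {p : A → ℝ} (_hp : IsCStarSeminorm p) : Type u := A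

namespace SeminormedCopy

variable {p : A → ℝ} (hp : IsCStarSeminorm p)

instance : NonUnitalRing (SeminormedCopy hp) := inferInstanceAs (NonUnitalRing A)
instance : StarRing (SeminormedCopy hp) := inferInstanceAs (StarRing A)
instance : Module ℂ (SeminormedCopy hp) := inferInstanceAs (Module ℂ A)
instance : IsScalarTower ℂ (SeminormedCopy hp) (SeminormedCopy hp) :=
  inferInstanceAs (IsScalarTower ℂ A A)
instance : SMulCommClass ℂ (SeminormedCopy hp) (SeminormedCopy hp) :=
  inferInstanceAs (SMulCommClass ℂ A A)
instance : StarModule ℂ (SeminormedCopy hp) := inferInstanceAs (StarModule ℂ A)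
instance : Norm (SeminormedCopy hp) := ⟨p⟩

instance : SeminormedAddCommGroup (SeminormedCopy hp) :=
  SeminormedAddCommGroup.ofCore (𝕜 := ℂ)
    { norm_nonneg := hp.nonneg
      norm_smul := hp.map_smul
      norm_triangle := hp.add_le }

instance : NormedSpace ℂ (SeminormedCopy hp) where
  norm_smul_le c a := (hp.map_smul c a).le

instance : NonUnitalSeminormedRing (SeminormedCopy hp) where
  dist_eq := dist_eq_norm_neg_add
  norm_mul_le := hp.mul_le

instance : NormedStarGroup (SeminormedCopy hp) where
  norm_star_le a := (hp.map_star a).le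

end SeminormedCopy

/-- The (Hausdorff) completion of the *-algebra `A` in the C*-seminorm `p`. -/
def CStarCompletion {p : A → ℝ} (hp : IsCStarSeminorm p) : Type u :=
  Completion (SeminormedCopy hp)

namespace CStarCompletion

variable {p : A → ℝ} (hp : IsCStarSeminorm p)

instance : NormedAddCommGroup (CStarCompletion hp) :=
  inferInstanceAs (NormedAddCommGroup (Completion (SeminormedCopy hp)))
instance : NormedSpace ℂ (CStarCompletion hp) :=
  inferInstanceAs (NormedSpace ℂ (Completion (SeminormedCopy hp)))
instance : CompleteSpace (CStarCompletion hp) :=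
  inferInstanceAs (CompleteSpace (Completion (SeminormedCopy hp)))

/-- The canonical map of `A` into its completion. -/
def of (a : A) : CStarCompletion hp := ((show SeminormedCopy hp from a) : Completion _)

theorem denseRange_of : DenseRange (of hp) :=
  Completion.denseRange_coe (α := SeminormedCopy hp)

theorem norm_of (a : A) : ‖of hp a‖ = p a :=
  Completion.norm_coe (E := SeminormedCopy hp) a

theorem of_add (a b : A) : of hp (a + b) = of hp a + of hp b :=
  Completion.coe_add (α := SeminormedCopy hp) a b

theorem of_zero : of hp 0 = 0 := Completion.coe_zero (α := SeminormedCopy hp)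

theorem of_smul (c : ℂ) (a : A) : of hp (c • a) = c • of hp a :=
  Completion.coe_smul (X := SeminormedCopy hp) c a

theorem continuous_of : Continuous fun a : SeminormedCopy hp => of hp a :=
  Completion.continuous_coe _

instance : Mul (CStarCompletion hp) :=
  ⟨Function.curry <| ((Completion.isDenseInducing_coe (α := SeminormedCopy hp)).prodMap
    (Completion.isDenseInducing_coe (α := SeminormedCopy hp))).extend
      fun q => of hp (q.1 * q.2 : SeminormedCopy hp)⟩

instance : Star (CStarCompletion hp) :=
  ⟨Completion.map (star : SeminormedCopy hp → SeminormedCopy hp)⟩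

theorem of_mul (a b : A) : of hp (a * b) = of hp a * of hp b :=
  (((Completion.isDenseInducing_coe (α := SeminormedCopy hp)).prodMap
    (Completion.isDenseInducing_coe (α := SeminormedCopy hp))).extend_eq
      ((continuous_of hp).comp (continuous_mul (M := SeminormedCopy hp))) (a, b)).symm

theorem of_star (a : A) : of hp (star a) = star (of hp a) :=
  (Completion.map_coe (α := SeminormedCopy hp) (β := SeminormedCopy hp)
    star_isometry.uniformContinuous a).symm

instance : ContinuousMul (CStarCompletion hp) where
  continuous_mul := by
    let m := (AddMonoidHom.mul : SeminormedCopy hp →+ SeminormedCopy hp →+ SeminormedCopy hp).compr₂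
      Completion.toCompl
    have : Continuous fun q : SeminormedCopy hp × SeminormedCopy hp => m q.1 q.2 :=
      (Completion.continuous_coe _).comp continuous_mul
    have di : IsDenseInducing (Completion.toCompl : SeminormedCopy hp → _) :=
      Completion.isDenseInducing_coe
    exact (di.extend_Z_bilin di this :)

instance : ContinuousStar (CStarCompletion hp) where
  continuous_star := Completion.continuous_map (α := SeminormedCopy hp) (β := SeminormedCopy hp)

@[elab_as_elim]
theorem induction_on {q : CStarCompletion hp → Prop} (x : CStarCompletion hp)
    (hc : IsClosed {x | q x}) (h : ∀ a, q (of hp a)) : q x :=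
  Completion.induction_on (α := SeminormedCopy hp) x hc h

theorem cid : Continuous fun x : CStarCompletion hp => x := continuous_id

theorem cc (y : CStarCompletion hp) : Continuous fun _ : CStarCompletion hp => y :=
  continuous_const

theorem cm {f g : CStarCompletion hp → CStarCompletion hp} (hf : Continuous f)
    (hg : Continuous g) : Continuous fun x => f x * g x := hf.mul hg

theorem ca {f g : CStarCompletion hp → CStarCompletion hp} (hf : Continuous f)
    (hg : Continuous g) : Continuous fun x => f x + g x := hf.add hg

theorem cs {f : CStarCompletion hp → CStarCompletion hp} (hf : Continuous f) :
    Continuous fun x => star (f x) := hf.star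

theorem csm (c : ℂ) {f : CStarCompletion hp → CStarCompletion hp} (hf : Continuous f) :
    Continuous fun x => c • f x := hf.const_smul c

theorem mul_assoc' (x y z : CStarCompletion hp) : x * y * z = x * (y * z) := by
  refine induction_on hp x (isClosed_eq (cm hp (cm hp (cid hp) (cc hp y)) (cc hp z))
    (cm hp (cid hp) (cc hp _))) fun a => ?_
  refine induction_on hp y (isClosed_eq (cm hp (cm hp (cc hp _) (cid hp)) (cc hp z))
    (cm hp (cc hp _) (cm hp (cid hp) (cc hp z)))) fun b => ?_
  refine induction_on hp z (isClosed_eq (cm hp (cc hp _) (cid hp))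
    (cm hp (cc hp _) (cm hp (cc hp _) (cid hp)))) fun c => ?_
  simp only [← of_mul, mul_assoc]

theorem mul_add' (x y z : CStarCompletion hp) : x * (y + z) = x * y + x * z := by
  refine induction_on hp x (isClosed_eq (cm hp (cid hp) (cc hp _))
    (ca hp (cm hp (cid hp) (cc hp _)) (cm hp (cid hp) (cc hp _)))) fun a => ?_
  refine induction_on hp y (isClosed_eq (cm hp (cc hp _) (ca hp (cid hp) (cc hp _)))
    (ca hp (cm hp (cc hp _) (cid hp)) (cc hp _))) fun b => ?_
  refine induction_on hp z (isClosed_eq (cm hp (cc hp _) (ca hp (cc hp _) (cid hp)))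
    (ca hp (cc hp _) (cm hp (cc hp _) (cid hp)))) fun c => ?_
  simp only [← of_mul, ← of_add, mul_add]

theorem add_mul' (x y z : CStarCompletion hp) : (x + y) * z = x * z + y * z := by
  refine induction_on hp x (isClosed_eq (cm hp (ca hp (cid hp) (cc hp _)) (cc hp _))
    (ca hp (cm hp (cid hp) (cc hp _)) (cc hp _))) fun a => ?_
  refine induction_on hp y (isClosed_eq (cm hp (ca hp (cc hp _) (cid hp)) (cc hp _))
    (ca hp (cc hp _) (cm hp (cid hp) (cc hp _)))) fun b => ?_
  refine induction_on hp z (isClosed_eq (cm hp (cc hp _) (cid hp))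
    (ca hp (cm hp (cc hp _) (cid hp)) (cm hp (cc hp _) (cid hp)))) fun c => ?_
  simp only [← of_mul, ← of_add, add_mul]

theorem norm_mul_le' (x y : CStarCompletion hp) : ‖x * y‖ ≤ ‖x‖ * ‖y‖ := by
  refine induction_on hp x (isClosed_le (cm hp (cid hp) (cc hp _)).norm
    ((cid hp).norm.mul continuous_const)) fun a => ?_
  refine induction_on hp y (isClosed_le (cm hp (cc hp _) (cid hp)).norm
    (continuous_const.mul (cid hp).norm)) fun b => ?_
  simpa only [← of_mul, norm_of] using hp.mul_le a b

instance : NonUnitalNormedRing (CStarCompletion hp) where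
  zero_mul x := by
    refine induction_on hp x (isClosed_eq (cm hp (cc hp _) (cid hp)) (cc hp _)) fun a => ?_
    rw [← of_zero, ← of_mul, zero_mul]
  mul_zero x := by
    refine induction_on hp x (isClosed_eq (cm hp (cid hp) (cc hp _)) (cc hp _)) fun a => ?_
    rw [← of_zero, ← of_mul, mul_zero]
  mul_assoc := mul_assoc' hp
  left_distrib := mul_add' hp
  right_distrib := add_mul' hp
  dist_eq := dist_eq_norm_neg_add
  norm_mul_le := norm_mul_le' hp

theorem star_mul' (x y : CStarCompletion hp) : star (x * y) = star y * star x := by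
  refine induction_on hp x (isClosed_eq (cs hp (cm hp (cid hp) (cc hp _)))
    (cm hp (cc hp _) (cs hp (cid hp)))) fun a => ?_
  refine induction_on hp y (isClosed_eq (cs hp (cm hp (cc hp _) (cid hp)))
    (cm hp (cs hp (cid hp)) (cc hp _))) fun b => ?_
  simp only [← of_mul, ← of_star, star_mul]

theorem star_add' (x y : CStarCompletion hp) : star (x + y) = star x + star y := by
  refine induction_on hp x (isClosed_eq (cs hp (ca hp (cid hp) (cc hp _)))
    (ca hp (cs hp (cid hp)) (cc hp _))) fun a => ?_
  refine induction_on hp y (isClosed_eq (cs hp (ca hp (cc hp _) (cid hp)))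
    (ca hp (cc hp _) (cs hp (cid hp)))) fun b => ?_
  simp only [← of_add, ← of_star, star_add]

instance : StarRing (CStarCompletion hp) where
  star_involutive x := by
    refine induction_on hp x (isClosed_eq (cs hp (cs hp (cid hp))) (cid hp)) fun a => ?_
    rw [← of_star, ← of_star, star_star]
  star_mul := star_mul' hp
  star_add := star_add' hp

instance : CStarRing (CStarCompletion hp) where
  norm_mul_self_le x := by
    refine induction_on hp x (isClosed_le ((cid hp).norm.mul (cid hp).norm)
      (cm hp (cs hp (cid hp)) (cid hp)).norm) fun a => ?_
    simpa only [← of_mul, ← of_star, norm_of] using (hp.cstar a).ge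

theorem smul_mul' (c : ℂ) (x y : CStarCompletion hp) : (c • x) * y = c • (x * y) := by
  refine induction_on hp x (isClosed_eq (cm hp (csm hp c (cid hp)) (cc hp _))
    (csm hp c (cm hp (cid hp) (cc hp _)))) fun a => ?_
  refine induction_on hp y (isClosed_eq (cm hp (cc hp _) (cid hp))
    (csm hp c (cm hp (cc hp _) (cid hp)))) fun b => ?_
  simp only [← of_mul, ← of_smul, smul_mul_assoc]

theorem mul_smul' (c : ℂ) (x y : CStarCompletion hp) : c • (x * y) = x * (c • y) := by
  refine induction_on hp x (isClosed_eq (csm hp c (cm hp (cid hp) (cc hp _)))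
    (cm hp (cid hp) (cc hp _))) fun a => ?_
  refine induction_on hp y (isClosed_eq (csm hp c (cm hp (cc hp _) (cid hp)))
    (cm hp (cc hp _) (csm hp c (cid hp)))) fun b => ?_
  simp only [← of_mul, ← of_smul, mul_smul_comm]

theorem star_smul' (c : ℂ) (x : CStarCompletion hp) : star (c • x) = star c • star x := by
  refine induction_on hp x (isClosed_eq (cs hp (csm hp c (cid hp)))
    (csm hp _ (cs hp (cid hp)))) fun a => ?_
  simp only [← of_star, ← of_smul, star_smul]

instance : IsScalarTower ℂ (CStarCompletion hp) (CStarCompletion hp) := ⟨smul_mul' hp⟩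

instance : SMulCommClass ℂ (CStarCompletion hp) (CStarCompletion hp) := ⟨mul_smul' hp⟩

instance : StarModule ℂ (CStarCompletion hp) := ⟨star_smul' hp⟩

instance : NonUnitalCStarAlgebra (CStarCompletion hp) where
  __ := (inferInstance : NormedSpace ℂ (CStarCompletion hp))
  smul_assoc := smul_mul' hp
  smul_comm := mul_smul' hp
  star_smul := star_smul' hp

theorem uniformContinuous_hom {B : Type u} [NonUnitalCStarAlgebra B] (π : A →⋆ₙₐ[ℂ] B)
    (hπ : ∀ a, ‖π a‖ ≤ p a) : UniformContinuous (fun a : SeminormedCopy hp => π a) :=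
  let f : SeminormedCopy hp →+ B :=
    { toFun := fun a => π a, map_zero' := map_zero π, map_add' := map_add π }
  (AddMonoidHomClass.lipschitz_of_bound (E := SeminormedCopy hp) f 1
    fun a => (hπ a).trans (one_mul (p a)).ge).uniformContinuous

/-- The continuous extension to the completion of a map dominated by `p`. -/
def extend {B : Type u} [NonUnitalCStarAlgebra B] (π : A →⋆ₙₐ[ℂ] B) : CStarCompletion hp → B :=
  Completion.extension (fun a : SeminormedCopy hp => π a)

theorem continuous_extend {B : Type u} [NonUnitalCStarAlgebra B] (π : A →⋆ₙₐ[ℂ] B) :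
    Continuous (extend hp π) :=
  Completion.continuous_extension

theorem extend_of {B : Type u} [NonUnitalCStarAlgebra B] (π : A →⋆ₙₐ[ℂ] B)
    (hπ : ∀ a, ‖π a‖ ≤ p a) (a : A) : extend hp π (of hp a) = π a :=
  Completion.extension_coe (uniformContinuous_hom hp π hπ) a

/-- A *-homomorphism into a C*-algebra which is dominated by `p` extends to the completion. -/
def lift {B : Type u} [NonUnitalCStarAlgebra B] (π : A →⋆ₙₐ[ℂ] B) (hπ : ∀ a, ‖π a‖ ≤ p a) :
    CStarCompletion hp →⋆ₙₐ[ℂ] B where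
  toFun := extend hp π
  map_smul' c x := by
    have hc := continuous_extend hp π
    refine induction_on hp x (isClosed_eq (hc.comp (csm hp c (cid hp)))
      (hc.const_smul c)) fun a => ?_
    rw [← of_smul, extend_of hp π hπ, extend_of hp π hπ, map_smul]; rfl
  map_zero' := by rw [← of_zero, extend_of hp π hπ, map_zero]
  map_add' x y := by
    have hc := continuous_extend hp π
    refine induction_on hp x (isClosed_eq (hc.comp (ca hp (cid hp) (cc hp y)))
      (hc.add continuous_const)) fun a => ?_
    refine induction_on hp y (isClosed_eq (hc.comp (ca hp (cc hp _) (cid hp)))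
      (continuous_const.add hc)) fun b => ?_
    rw [← of_add, extend_of hp π hπ, extend_of hp π hπ, extend_of hp π hπ, map_add]
  map_mul' x y := by
    have hc := continuous_extend hp π
    refine induction_on hp x (isClosed_eq (hc.comp (cm hp (cid hp) (cc hp y)))
      (hc.mul continuous_const)) fun a => ?_
    refine induction_on hp y (isClosed_eq (hc.comp (cm hp (cc hp _) (cid hp)))
      (continuous_const.mul hc)) fun b => ?_
    rw [← of_mul, extend_of hp π hπ, extend_of hp π hπ, extend_of hp π hπ, map_mul]
  map_star' x := by
    have hc := continuous_extend hp π
    refine induction_on hp x (isClosed_eq (hc.comp (cs hp (cid hp))) hc.star) fun a => ?_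
    rw [← of_star, extend_of hp π hπ, extend_of hp π hπ, map_star]

theorem lift_of {B : Type u} [NonUnitalCStarAlgebra B] (π : A →⋆ₙₐ[ℂ] B)
    (hπ : ∀ a, ‖π a‖ ≤ p a) (a : A) : lift hp π hπ (of hp a) = π a :=
  extend_of hp π hπ a

/-- Two *-homomorphisms on the completion that agree on `A` are equal. -/
theorem hom_ext {B : Type u} [NonUnitalCStarAlgebra B] {φ ψ : CStarCompletion hp →⋆ₙₐ[ℂ] B}
    (h : ∀ a, φ (of hp a) = ψ (of hp a)) : φ = ψ := by
  ext x
  exact induction_on hp x (isClosed_eq (map_continuous φ) (map_continuous ψ)) h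

end CStarCompletion

end Completion

/-! ### The free *-algebra on a set -/

section Free

/-- The free (non-unital, complex) *-algebra on a set `X`: the semigroup algebra of the free
semigroup on the letters `(x, false)`, standing for `x`, and `(x, true)`, standing for `x*`. -/
def FreeStarAlgebra (X : Type u) : Type u := MonoidAlgebra ℂ (FreeSemigroup (X × Bool))

namespace FreeStarAlgebra

variable {X : Type u}

instance : NonUnitalRing (FreeStarAlgebra X) :=
  inferInstanceAs (NonUnitalRing (MonoidAlgebra ℂ (FreeSemigroup (X × Bool))))
instance : Module ℂ (FreeStarAlgebra X) :=
  inferInstanceAs (Module ℂ (MonoidAlgebra ℂ (FreeSemigroup (X × Bool))))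
instance : IsScalarTower ℂ (FreeStarAlgebra X) (FreeStarAlgebra X) :=
  inferInstanceAs (IsScalarTower ℂ (MonoidAlgebra ℂ (FreeSemigroup (X × Bool)))
    (MonoidAlgebra ℂ (FreeSemigroup (X × Bool))))
instance : SMulCommClass ℂ (FreeStarAlgebra X) (FreeStarAlgebra X) :=
  inferInstanceAs (SMulCommClass ℂ (MonoidAlgebra ℂ (FreeSemigroup (X × Bool)))
    (MonoidAlgebra ℂ (FreeSemigroup (X × Bool))))

/-- The word `w` with coefficient `c`. -/
def word (w : FreeSemigroup (X × Bool)) (c : ℂ) : FreeStarAlgebra X := MonoidAlgebra.single w c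

/-- The generator `x`. -/
def gen (x : X) : FreeStarAlgebra X := word (FreeSemigroup.of (x, false)) 1

/-- Reversing a word and exchanging `x` and `x*`. -/
def adj : FreeSemigroup (X × Bool) →ₙ* (FreeSemigroup (X × Bool))ᵐᵒᵖ :=
  FreeSemigroup.lift fun q => MulOpposite.op (FreeSemigroup.of (q.1, !q.2))

theorem adj_of (q : X × Bool) :
    (adj (FreeSemigroup.of q)).unop = FreeSemigroup.of (q.1, !q.2) := rfl

theorem adj_mul (v w : FreeSemigroup (X × Bool)) :
    (adj (v * w)).unop = (adj w).unop * (adj v).unop := by simp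

theorem adj_adj (w : FreeSemigroup (X × Bool)) : (adj (adj w).unop).unop = w := by
  induction w using FreeSemigroup.recOnMul with
  | ih1 q => simp [adj_of]
  | ih2 q w h1 h2 => rw [adj_mul, adj_mul, h1, h2]

/-- The conjugate linear extension of `adj`. -/
def starHom : FreeStarAlgebra X →+ FreeStarAlgebra X :=
  (Finsupp.liftAddHom fun w =>
    { toFun := fun c => word (adj w).unop (star c)
      map_zero' := by simp [word]; rfl
      map_add' := fun a b => by simp [word]; rfl }).comp
    (MonoidAlgebra.coeffAddEquiv (R := ℂ) (M := FreeSemigroup (X × Bool))).toAddMonoidHom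

theorem starHom_word (w : FreeSemigroup (X × Bool)) (c : ℂ) :
    starHom (word w c) = word (adj w).unop (star c) := by
  exact Finsupp.liftAddHom_apply_single _ w c

theorem word_mul (v w : FreeSemigroup (X × Bool)) (c d : ℂ) :
    word v c * word w d = word (v * w) (c * d) :=
  MonoidAlgebra.single_mul_single ..

theorem smul_word (w : FreeSemigroup (X × Bool)) (c d : ℂ) :
    c • word w d = word w (c * d) :=
  MonoidAlgebra.smul_single ..

@[elab_as_elim]
theorem induction {q : FreeStarAlgebra X → Prop} (x : FreeStarAlgebra X) (h0 : q 0)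
    (ha : ∀ x y, q x → q y → q (x + y)) (hw : ∀ w c, q (word w c)) : q x :=
  MonoidAlgebra.induction_linear x h0 ha hw

instance : StarRing (FreeStarAlgebra X) where
  star := starHom
  star_involutive x := by
    induction x using FreeStarAlgebra.induction with
    | h0 => simp
    | ha x y hx hy => simp [hx, hy]
    | hw w c =>
      rw [starHom_word, starHom_word, adj_adj, star_star]
  star_mul x y := by
    induction x using FreeStarAlgebra.induction with
    | h0 => simp
    | ha x y hx hy => simp_all [add_mul, mul_add]
    | hw v c =>
      induction y using FreeStarAlgebra.induction with
      | h0 => simp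
      | ha x y hx hy => simp_all [add_mul, mul_add]
      | hw w d =>
        rw [word_mul, starHom_word, starHom_word, starHom_word, word_mul, adj_mul, star_mul]
  star_add := map_add starHom

theorem star_word (w : FreeSemigroup (X × Bool)) (c : ℂ) :
    star (word w c) = word (adj w).unop (star c) := starHom_word w c

instance : StarModule ℂ (FreeStarAlgebra X) where
  star_smul c x := by
    induction x using FreeStarAlgebra.induction with
    | h0 => simp
    | ha x y hx hy => simp_all
    | hw w d =>
      rw [smul_word, star_word, star_word, smul_word, star_mul, mul_comm]

variable {B : Type u} [NonUnitalCStarAlgebra B]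

/-- The value of a word under `x ↦ S x`, `x* ↦ (S x)*`. -/
def evalWord (S : X → B) : FreeSemigroup (X × Bool) →ₙ* B :=
  FreeSemigroup.lift fun q => bif q.2 then star (S q.1) else S q.1

theorem evalWord_of (S : X → B) (q : X × Bool) :
    evalWord S (FreeSemigroup.of q) = bif q.2 then star (S q.1) else S q.1 := rfl

theorem evalWord_adj (S : X → B) (w : FreeSemigroup (X × Bool)) :
    evalWord S (adj w).unop = star (evalWord S w) := by
  induction w using FreeSemigroup.recOnMul with
  | ih1 q => obtain ⟨x, b⟩ := q; cases b <;> simp [adj_of, evalWord_of]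
  | ih2 q w h1 h2 => rw [adj_mul, map_mul, map_mul, h1, h2, star_mul]

/-- The extension of a map `S : X → B` to the free *-algebra, as a linear multiplicative map. -/
def liftAux (S : X → B) : FreeStarAlgebra X →ₙₐ[ℂ] B := MonoidAlgebra.liftMagma ℂ (evalWord S)

theorem liftAux_word (S : X → B) (w : FreeSemigroup (X × Bool)) (c : ℂ) :
    liftAux S (word w c) = c • evalWord S w := by
  change (Finsupp.single w c).sum (fun w c => c • evalWord S w) = _
  simp

/-- The *-homomorphism on the free *-algebra that extends a map `S : X → B`. -/
def lift (S : X → B) : FreeStarAlgebra X →⋆ₙₐ[ℂ] B where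
  __ := liftAux S
  map_star' x := by
    change liftAux S (star x) = star (liftAux S x)
    induction x using FreeStarAlgebra.induction with
    | h0 => simp
    | ha x y hx hy => simp_all
    | hw w d =>
      rw [star_word, liftAux_word, liftAux_word, evalWord_adj, star_smul]

theorem lift_word (S : X → B) (w : FreeSemigroup (X × Bool)) (c : ℂ) :
    lift S (word w c) = c • evalWord S w := liftAux_word S w c

theorem lift_gen (S : X → B) (x : X) : lift S (gen x) = S x := by
  simp [gen, lift_word, evalWord_of]

/-- Two *-homomorphisms on the free *-algebra that agree on the generators are equal. -/
theorem hom_ext {φ ψ : FreeStarAlgebra X →⋆ₙₐ[ℂ] B} (h : ∀ x, φ (gen x) = ψ (gen x)) :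
    φ = ψ := by
  have h1 : ∀ w, φ (word w 1) = ψ (word w 1) := fun w => by
    induction w using FreeSemigroup.recOnMul with
    | ih1 q =>
      obtain ⟨x, b⟩ := q
      cases b
      · exact h x
      · have : word (FreeSemigroup.of (x, true)) 1 = star (gen x) := by
          rw [gen, star_word]; simp [adj_of]
        rw [this, map_star, map_star, h]
    | ih2 q w h1 h2 =>
      have : word (FreeSemigroup.of q * w) (1 : ℂ) = word (FreeSemigroup.of q) 1 * word w 1 := by
        rw [word_mul, one_mul]
      rw [this, map_mul, map_mul, h1, h2]
  ext x
  induction x using FreeStarAlgebra.induction with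
  | h0 => simp
  | ha x y hx hy => simp_all
  | hw w c =>
    have : word w c = c • word w 1 := by rw [smul_word, mul_one]
    rw [this, map_smul, map_smul, h1]

/-- A uniform bound for the image of an element, if the generators go to contractions. -/
theorem exists_bound (x : FreeStarAlgebra X) : ∃ C : ℝ, ∀ (B : Type u) [NonUnitalCStarAlgebra B]
    (S : X → B), (∀ x, ‖S x‖ ≤ 1) → ‖lift S x‖ ≤ C := by
  induction x using FreeStarAlgebra.induction with
  | h0 => exact ⟨0, fun B _ S _ => by simp⟩
  | ha x y hx hy =>
    obtain ⟨C, hC⟩ := hx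
    obtain ⟨D, hD⟩ := hy
    exact ⟨C + D, fun B _ S hS => by
      rw [map_add]; exact (norm_add_le _ _).trans (add_le_add (hC B S hS) (hD B S hS))⟩
  | hw w c =>
    refine ⟨‖c‖, fun B _ S hS => ?_⟩
    have : ‖evalWord S w‖ ≤ 1 := by
      induction w using FreeSemigroup.recOnMul with
      | ih1 q => obtain ⟨x, b⟩ := q; cases b <;> simpa [evalWord_of] using hS x
      | ih2 q w h1 h2 =>
        rw [map_mul]
        exact (norm_mul_le _ _).trans (mul_le_one₀ h1 (norm_nonneg _) h2)
    rw [lift_word, norm_smul]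
    exact mul_le_of_le_one_right (norm_nonneg _) this

end FreeStarAlgebra

end Free

/-! ### Small categories as sets of morphisms

The set of morphisms of a small category `C` is `Arrow C`; the source and the target of a morphism
`f` are `f.left` and `f.right`.  The product `fg` is the composition "first `g`, then `f`". -/

section Categories

namespace Mor

variable {C : Type u} [Category.{u} C]

/-- The pair `(f, g)` is composable: the source of `f` is the target of `g`. -/
def Composable (f g : Arrow C) : Prop := f.left = g.right

/-- The product `fg` of a composable pair. -/
def comp (f g : Arrow C) (h : Composable f g) : Arrow C :=
  Arrow.mk (g.hom ≫ eqToHom (Eq.symm h) ≫ f.hom)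

/-- The unit at the object `x`, as a morphism. -/
def unit (x : C) : Arrow C := Arrow.mk (𝟙 x)

theorem comp_mk {a b c : C} (f : b ⟶ c) (g : a ⟶ b) (h : Composable (Arrow.mk f) (Arrow.mk g)) :
    comp (Arrow.mk f) (Arrow.mk g) h = Arrow.mk (g ≫ f) := by
  simp [comp]

theorem comp_left (f g : Arrow C) (h : Composable f g) : (comp f g h).left = g.left := rfl

theorem comp_right (f g : Arrow C) (h : Composable f g) : (comp f g h).right = f.right := rfl

theorem exists_mk (f : Arrow C) : ∃ (a b : C) (g : a ⟶ b), f = Arrow.mk g := ⟨_, _, f.hom, rfl⟩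

theorem comp_assoc (f g k : Arrow C) (h : Composable f g) (h' : Composable g k) :
    comp (comp f g h) k h' = comp f (comp g k h') h := by
  obtain ⟨a, b, f, rfl⟩ := exists_mk f
  obtain ⟨c, d, g, rfl⟩ := exists_mk g
  obtain ⟨x, y, k, rfl⟩ := exists_mk k
  cases h; cases h'
  change Arrow.mk (k ≫ 𝟙 _ ≫ (g ≫ 𝟙 _ ≫ f)) = Arrow.mk ((k ≫ 𝟙 _ ≫ g) ≫ 𝟙 _ ≫ f)
  simp

theorem comp_unit (f : Arrow C) (x : C) (h : Composable f (unit x)) : comp f (unit x) h = f := by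
  obtain ⟨a, b, f, rfl⟩ := exists_mk f
  cases h
  change Arrow.mk (𝟙 _ ≫ 𝟙 _ ≫ f) = Arrow.mk f
  simp

theorem unit_comp (f : Arrow C) (x : C) (h : Composable (unit x) f) : comp (unit x) f h = f := by
  obtain ⟨a, b, f, rfl⟩ := exists_mk f
  cases h
  change Arrow.mk (f ≫ 𝟙 _ ≫ 𝟙 _) = Arrow.mk f
  simp

/-- `f` and `g` intersect if they have a common multiple `fk = gl`. -/
def Intersect (f g : Arrow C) : Prop :=
  ∃ (k l : Arrow C) (hk : Composable f k) (hl : Composable g l), comp f k hk = comp g l hl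

/-- `f ⊥ g`: there is no common multiple. -/
def Disjoint (f g : Arrow C) : Prop := ¬Intersect f g

end Mor

/-- A representation of the small category `Λ` in a C*-algebra `B`.  (No condition involves a unit
of `B`; a representation in `B` is a representation in the unitization of `B` with values in
`B`.) -/
structure IsCatRepresentation {Λ : Type u} [Category.{u} Λ] {B : Type u} [NonUnitalCStarAlgebra B]
    (S : Arrow Λ → B) : Prop where
  /-- each `S f` is a partial isometry -/
  partialIsometry : ∀ f, S f * star (S f) * S f = S f
  mul_of_composable : ∀ f g (h : Mor.Composable f g), S f * S g = S (Mor.comp f g h)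
  mul_of_not_composable : ∀ f g, ¬Mor.Composable f g → S f * S g = 0
  /-- the initial projections `S f* S f` commute amongst themselves -/
  commute_initial : ∀ f g, Commute (star (S f) * S f) (star (S g) * S g)
  /-- the final projections `S f S f*` commute amongst themselves -/
  commute_final : ∀ f g, Commute (S f * star (S f)) (S g * star (S g))
  /-- initial projections commute with final projections -/
  commute_initial_final : ∀ f g, Commute (star (S f) * S f) (S g * star (S g))
  final_mul_final : ∀ f g, Mor.Disjoint f g → S f * star (S f) * (S g * star (S g)) = 0
  initial_mul_final : ∀ f g, Mor.Composable f g →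
    star (S f) * S f * (S g * star (S g)) = S g * star (S g)

theorem IsCatRepresentation.norm_le_one {Λ : Type u} [Category.{u} Λ] {B : Type u}
    [NonUnitalCStarAlgebra B] {S : Arrow Λ → B} (hS : IsCatRepresentation S) (f : Arrow Λ) :
    ‖S f‖ ≤ 1 := by
  have h1 : star (S f) * S f * (star (S f) * S f) = star (S f) * S f := by
    rw [mul_assoc, ← mul_assoc (S f), hS.partialIsometry]
  have h2 : ‖star (S f) * S f‖ * ‖star (S f) * S f‖ = ‖star (S f) * S f‖ := by
    conv_rhs => rw [← h1]
    have := CStarRing.norm_star_mul_self (x := star (S f) * S f)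
    rw [← this, star_mul, star_star]
  rw [CStarRing.norm_star_mul_self] at h2
  by_contra hlt
  push Not at hlt
  nlinarith [mul_pos (show (0 : ℝ) < ‖S f‖ by linarith) (show (0 : ℝ) < ‖S f‖ by linarith),
    mul_lt_mul'' hlt hlt zero_le_one zero_le_one]

theorem isCatRepresentation_zero {Λ : Type u} [Category.{u} Λ] {B : Type u}
    [NonUnitalCStarAlgebra B] : IsCatRepresentation (fun _ : Arrow Λ => (0 : B)) := by
  constructor <;> simp

/-! ### The C*-algebra of a small category -/

variable (Λ : Type u) [Category.{u} Λ]

/-- The C*-seminorms on the free *-algebra on the morphisms of `Λ` which are given by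
representations of `Λ` in C*-algebras. -/
def catSeminorms : Set (FreeStarAlgebra (Arrow Λ) → ℝ) :=
  {p | ∃ (B : Type u) (_ : NonUnitalCStarAlgebra B) (S : Arrow Λ → B),
    IsCatRepresentation S ∧ p = fun x => ‖FreeStarAlgebra.lift S x‖}

theorem catSeminorms_bounded (x : FreeStarAlgebra (Arrow Λ)) :
    ∃ C, ∀ p ∈ catSeminorms Λ, p x ≤ C := by
  obtain ⟨C, hC⟩ := FreeStarAlgebra.exists_bound x
  refine ⟨C, ?_⟩
  rintro _ ⟨B, _, S, hS, rfl⟩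
  exact hC B S hS.norm_le_one

/-- The greatest C*-seminorm given by representations of `Λ`. -/
def catSeminorm (x : FreeStarAlgebra (Arrow Λ)) : ℝ := ⨆ p : catSeminorms Λ, p.1 x

theorem isCStarSeminorm_catSeminorm : IsCStarSeminorm (catSeminorm Λ) :=
  IsCStarSeminorm.iSup
    ⟨_, PEmpty.{u + 1} → ℂ, inferInstance, fun _ => 0, isCatRepresentation_zero, rfl⟩
    (by rintro _ ⟨B, _, S, -, rfl⟩; exact IsCStarSeminorm.ofHom _) (catSeminorms_bounded Λ)

/-- The C*-algebra `C*(Λ)` of a small category: the universal C*-algebra generated by partial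
isometries `S f`, for `f` a morphism of `Λ`, subject to the relation that `S` is a representation
of `Λ`. -/
def CatCStar : Type u := CStarCompletion (isCStarSeminorm_catSeminorm Λ)

instance : NonUnitalCStarAlgebra (CatCStar Λ) :=
  inferInstanceAs (NonUnitalCStarAlgebra (CStarCompletion (isCStarSeminorm_catSeminorm Λ)))

namespace CatCStar

variable {Λ}

/-- The generators of `C*(Λ)`. -/
def S (f : Arrow Λ) : CatCStar Λ := CStarCompletion.of _ (FreeStarAlgebra.gen f)

section lift

variable {B : Type u} [NonUnitalCStarAlgebra B] (T : Arrow Λ → B) (hT : IsCatRepresentation T)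

theorem norm_lift_le (hT : IsCatRepresentation T) (x : FreeStarAlgebra (Arrow Λ)) :
    ‖FreeStarAlgebra.lift T x‖ ≤ catSeminorm Λ x := by
  obtain ⟨C, hC⟩ := catSeminorms_bounded Λ x
  exact le_ciSup (f := fun p : catSeminorms Λ => p.1 x)
    ⟨C, by rintro _ ⟨p, rfl⟩; exact hC p.1 p.2⟩ ⟨_, B, _, T, hT, rfl⟩

/-- The *-homomorphism `C*(Λ) → B` that extends a representation `T` of `Λ` in `B`. -/
def lift : CatCStar Λ →⋆ₙₐ[ℂ] B :=
  CStarCompletion.lift _ (FreeStarAlgebra.lift T) (norm_lift_le T hT)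

theorem lift_S (f : Arrow Λ) : lift T hT (S f) = T f :=
  (CStarCompletion.lift_of _ _ _ _).trans (FreeStarAlgebra.lift_gen T f)

end lift

/-- The canonical *-homomorphism from the free *-algebra. -/
def ofFree : FreeStarAlgebra (Arrow Λ) →⋆ₙₐ[ℂ] CatCStar Λ where
  toFun := CStarCompletion.of (isCStarSeminorm_catSeminorm Λ)
  map_smul' c x := CStarCompletion.of_smul _ c x
  map_zero' := CStarCompletion.of_zero _
  map_add' x y := CStarCompletion.of_add _ x y
  map_mul' x y := CStarCompletion.of_mul _ x y
  map_star' x := CStarCompletion.of_star _ x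

theorem hom_ext {B : Type u} [NonUnitalCStarAlgebra B] {φ ψ : CatCStar Λ →⋆ₙₐ[ℂ] B}
    (h : ∀ f, φ (S f) = ψ (S f)) : φ = ψ :=
  CStarCompletion.hom_ext _ fun a =>
    DFunLike.congr_fun (FreeStarAlgebra.hom_ext (φ := φ.comp ofFree) (ψ := ψ.comp ofFree) h) a

/-- An element of the free *-algebra vanishes in `C*(Λ)` if it does in every representation. -/
theorem ofFree_eq_zero {x : FreeStarAlgebra (Arrow Λ)}
    (h : ∀ (B : Type u) [NonUnitalCStarAlgebra B] (T : Arrow Λ → B), IsCatRepresentation T →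
      FreeStarAlgebra.lift T x = 0) : ofFree x = 0 := by
  rw [← norm_eq_zero]
  have h1 : ‖ofFree x‖ = catSeminorm Λ x := CStarCompletion.norm_of _ x
  rw [h1, catSeminorm]
  have : ∀ p : catSeminorms Λ, p.1 x = 0 := by
    rintro ⟨_, B, _, T, hT, rfl⟩
    simp [h B T hT]
  simp [this]

theorem ofFree_eq {x y : FreeStarAlgebra (Arrow Λ)}
    (h : ∀ (B : Type u) [NonUnitalCStarAlgebra B] (T : Arrow Λ → B), IsCatRepresentation T →
      FreeStarAlgebra.lift T x = FreeStarAlgebra.lift T y) : ofFree x = ofFree y := by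
  rw [← sub_eq_zero, ← map_sub]
  exact ofFree_eq_zero fun B _ T hT => by rw [map_sub, h B T hT, sub_self]

theorem isCatRepresentation_S : IsCatRepresentation (S : Arrow Λ → CatCStar Λ) := by
  have hS : ∀ f : Arrow Λ, S f = ofFree (FreeStarAlgebra.gen f) := fun _ => rfl
  constructor <;> intros <;> simp only [hS, Commute, SemiconjBy, ← map_mul, ← map_star]
  · exact ofFree_eq fun B _ T hT => by
      simp only [map_mul, map_star, FreeStarAlgebra.lift_gen, hT.partialIsometry]
  · rename_i h
    exact ofFree_eq fun B _ T hT => by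
      simp only [map_mul, FreeStarAlgebra.lift_gen, hT.mul_of_composable _ _ h]
  · rename_i h
    exact ofFree_eq_zero fun B _ T hT => by
      simp only [map_mul, FreeStarAlgebra.lift_gen, hT.mul_of_not_composable _ _ h]
  · exact ofFree_eq fun B _ T hT => by
      simp only [map_mul, map_star, FreeStarAlgebra.lift_gen, (hT.commute_initial _ _).eq]
  · exact ofFree_eq fun B _ T hT => by
      simp only [map_mul, map_star, FreeStarAlgebra.lift_gen, (hT.commute_final _ _).eq]
  · exact ofFree_eq fun B _ T hT => by
      simp only [map_mul, map_star, FreeStarAlgebra.lift_gen, (hT.commute_initial_final _ _).eq]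
  · rename_i h
    exact ofFree_eq_zero fun B _ T hT => by
      simp only [map_mul, map_star, FreeStarAlgebra.lift_gen, hT.final_mul_final _ _ h]
  · rename_i h
    exact ofFree_eq fun B _ T hT => by
      simp only [map_mul, map_star, FreeStarAlgebra.lift_gen, hT.initial_mul_final _ _ h]

theorem ofFree_eq_lift (x : FreeStarAlgebra (Arrow Λ)) : ofFree x = FreeStarAlgebra.lift S x :=
  DFunLike.congr_fun (FreeStarAlgebra.hom_ext (φ := ofFree) (ψ := FreeStarAlgebra.lift S)
    fun f => (FreeStarAlgebra.lift_gen S f).symm) x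

/-- A closed *-subalgebra of `C*(Λ)` that contains the generators is all of `C*(Λ)`. -/
theorem mem_of_S (K : NonUnitalStarSubalgebra ℂ (CatCStar Λ)) (hK : IsClosed (K : Set (CatCStar Λ)))
    (hS : ∀ f, S f ∈ K) (a : CatCStar Λ) : a ∈ K := by
  refine CStarCompletion.induction_on _ (q := fun a : CatCStar Λ => a ∈ K) a hK fun x => ?_
  change ofFree x ∈ K
  rw [ofFree_eq_lift]
  induction x using FreeStarAlgebra.induction with
  | h0 => rw [map_zero]; exact zero_mem K
  | ha x y hx hy => rw [map_add]; exact add_mem hx hy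
  | hw w c =>
    rw [FreeStarAlgebra.lift_word]
    refine SMulMemClass.smul_mem c ?_
    induction w using FreeSemigroup.recOnMul with
    | ih1 q =>
      obtain ⟨f, b⟩ := q
      cases b
      · exact hS f
      · exact star_mem (hS f)
    | ih2 q w h1 h2 => rw [map_mul]; exact mul_mem h1 h2

end CatCStar

end Categories

/-! ### Quasi-actions of groupoids on C*-algebras, and crossed products -/

section CrossedProducts

namespace Mor

variable {G : Type u} [Groupoid.{u} G]

/-- The inverse of an element of a groupoid. -/
def inv (g : Arrow G) : Arrow G := Arrow.mk (Groupoid.inv g.hom)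

theorem inv_inv (g : Arrow G) : inv (inv g) = g := by
  obtain ⟨a, b, g, rfl⟩ := exists_mk g
  simp [inv]

theorem composable_unit (g : Arrow G) : Composable g (unit g.left) := rfl

theorem composable_unit_unit (x : G) : Composable (unit x) (unit x) := rfl

theorem composable_self_inv (g : Arrow G) : Composable g (inv g) := rfl

theorem composable_inv_self (g : Arrow G) : Composable (inv g) g := rfl

theorem comp_inv (g : Arrow G) : comp g (inv g) (composable_self_inv g) = unit g.right := by
  obtain ⟨a, b, g, rfl⟩ := exists_mk g
  exact (comp_mk g (Groupoid.inv g) rfl).trans (congrArg Arrow.mk (Groupoid.inv_comp g))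

theorem inv_comp (g : Arrow G) : comp (inv g) g (composable_inv_self g) = unit g.left := by
  obtain ⟨a, b, g, rfl⟩ := exists_mk g
  exact (comp_mk (Groupoid.inv g) g rfl).trans (congrArg Arrow.mk (Groupoid.comp_inv g))

theorem composable_inv {f g : Arrow G} : Composable (inv g) (inv f) ↔ Composable f g :=
  ⟨fun h => Eq.symm h, fun h => Eq.symm h⟩

theorem inv_comp_rev (f g : Arrow G) (h : Composable f g) :
    inv (comp f g h) = comp (inv g) (inv f) (composable_inv.2 h) := by
  obtain ⟨a, b, f, rfl⟩ := exists_mk f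
  obtain ⟨c, d, g, rfl⟩ := exists_mk g
  cases h
  refine (congrArg inv (comp_mk f g rfl)).trans (Eq.trans ?_ (comp_mk _ _ rfl).symm)
  change Arrow.mk _ = Arrow.mk _
  congr 1
  simp

end Mor

/-- A quasi-action of a (discrete) groupoid `G` on a C*-algebra `A`: for each `g` a pair of a
*-homomorphism `β g : A → A` and a closed *-subalgebra `D (β g)` of `A` that `β g` maps bijectively
onto `β g (A)`. -/
structure QuasiAction (G : Type u) [Groupoid.{u} G] (A : Type u) [NonUnitalCStarAlgebra A] where
  /-- the *-homomorphism `β g` -/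
  hom : Arrow G → A →⋆ₙₐ[ℂ] A
  /-- the *-subalgebra `D (β g)` -/
  dom : Arrow G → NonUnitalStarSubalgebra ℂ A
  isClosed_dom : ∀ g, IsClosed (dom g : Set A)
  bijOn : ∀ g, Set.BijOn (hom g) (dom g) (Set.range (hom g))
  range_eq_dom : ∀ s t, Mor.Composable s t → Set.range (hom t) = dom s
  dom_comp : ∀ s t (h : Mor.Composable s t), dom (Mor.comp s t h) = dom t
  hom_comp : ∀ s t (h : Mor.Composable s t), hom (Mor.comp s t h) = (hom s).comp (hom t)
  hom_comp_eq_zero : ∀ s t, ¬Mor.Composable s t → (hom s).comp (hom t) = 0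

namespace QuasiAction

variable {G : Type u} [Groupoid.{u} G] {A : Type u} [NonUnitalCStarAlgebra A]
  (β : QuasiAction G A)

theorem hom_comp_apply (s t : Arrow G) (h : Mor.Composable s t) (a : A) :
    β.hom (Mor.comp s t h) a = β.hom s (β.hom t a) := by
  rw [β.hom_comp s t h]; rfl

theorem dom_eq_unit (s : Arrow G) : β.dom s = β.dom (Mor.unit s.left) := by
  rw [← β.dom_comp s (Mor.unit s.left) (Mor.composable_unit s), Mor.comp_unit]

theorem dom_eq {s t : Arrow G} (h : s.left = t.left) : β.dom s = β.dom t := by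
  rw [dom_eq_unit, h, ← dom_eq_unit]

theorem hom_mem (t : Arrow G) (a : A) : β.hom t a ∈ β.dom (Mor.inv t) := by
  have h : β.hom t a ∈ (β.dom (Mor.inv t) : Set A) := by
    rw [← β.range_eq_dom (Mor.inv t) t (Mor.composable_inv_self t)]; exact ⟨a, rfl⟩
  exact h

theorem hom_unit (x : G) {a : A} (ha : a ∈ β.dom (Mor.unit x)) : β.hom (Mor.unit x) a = a := by
  have h2 : ∀ b, β.hom (Mor.unit x) (β.hom (Mor.unit x) b) = β.hom (Mor.unit x) b := fun b => by
    rw [← β.hom_comp_apply (Mor.unit x) (Mor.unit x) (Mor.composable_unit_unit x), Mor.comp_unit]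
  have hm : β.hom (Mor.unit x) a ∈ β.dom (Mor.unit x) := by
    rw [β.dom_eq (s := Mor.unit x) (t := Mor.inv (Mor.unit x)) rfl]
    exact β.hom_mem _ a
  exact (β.bijOn (Mor.unit x)).injOn hm ha (h2 a)

theorem hom_hom_inv (t : Arrow G) {a : A} (ha : a ∈ β.dom (Mor.inv t)) :
    β.hom t (β.hom (Mor.inv t) a) = a := by
  rw [← β.hom_comp_apply t (Mor.inv t) (Mor.composable_self_inv t), Mor.comp_inv]
  refine β.hom_unit _ ?_
  rwa [β.dom_eq (s := Mor.unit t.right) (t := Mor.inv t) rfl]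

theorem hom_inv_hom (t : Arrow G) {a : A} (ha : a ∈ β.dom t) :
    β.hom (Mor.inv t) (β.hom t a) = a := by
  have h := β.hom_hom_inv (Mor.inv t) (a := a) (by rwa [Mor.inv_inv])
  rwa [Mor.inv_inv] at h

/-! #### The *-algebra `A[G]` -/

open Classical in
/-- The product `(a t) (b v) = a β_t(b) tv` of two monomials, which is `0` if `tv` is not
defined. -/
def mulTerm (t : Arrow G) (a : A) (v : Arrow G) (b : A) : Arrow G →₀ A :=
  if h : Mor.Composable t v then Finsupp.single (Mor.comp t v h) (a * β.hom t b) else 0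

/-- The product of two finite sums `∑ a_t t` and `∑ b_v v`. -/
def mul (f g : Arrow G →₀ A) : Arrow G →₀ A := f.sum fun t a => g.sum fun v b => β.mulTerm t a v b

/-- The adjoint `(∑ a_t t)* = ∑ β_{t⁻¹}(a_t*) t⁻¹`. -/
def adjoint (f : Arrow G →₀ A) : Arrow G →₀ A :=
  f.sum fun t a => Finsupp.single (Mor.inv t) (β.hom (Mor.inv t) (star a))

/-- The `ℓ¹`-norm of a finite sum. -/
def l1Norm (f : Arrow G →₀ A) : ℝ := f.sum fun _ a => ‖a‖

theorem mulTerm_zero_left (t : Arrow G) (v : Arrow G) (b : A) : β.mulTerm t 0 v b = 0 := by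
  simp [mulTerm]

theorem mulTerm_zero_right (t : Arrow G) (a : A) (v : Arrow G) : β.mulTerm t a v 0 = 0 := by
  simp [mulTerm]

theorem mulTerm_add_left (t : Arrow G) (a a' : A) (v : Arrow G) (b : A) :
    β.mulTerm t (a + a') v b = β.mulTerm t a v b + β.mulTerm t a' v b := by
  unfold mulTerm; split_ifs <;> simp [add_mul]

theorem mulTerm_add_right (t : Arrow G) (a : A) (v : Arrow G) (b b' : A) :
    β.mulTerm t a v (b + b') = β.mulTerm t a v b + β.mulTerm t a v b' := by
  unfold mulTerm; split_ifs <;> simp [mul_add]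

theorem mul_add (f g h : Arrow G →₀ A) : β.mul f (g + h) = β.mul f g + β.mul f h := by
  unfold mul
  rw [← Finsupp.sum_add]
  exact Finsupp.sum_congr fun t _ => Finsupp.sum_add_index'
    (fun v => β.mulTerm_zero_right _ _ v) fun v => β.mulTerm_add_right _ _ v

theorem add_mul (f g h : Arrow G →₀ A) : β.mul (f + g) h = β.mul f h + β.mul g h :=
  Finsupp.sum_add_index' (fun t => by simp [mulTerm_zero_left]) fun t a b => by
    rw [← Finsupp.sum_add]
    exact Finsupp.sum_congr fun v _ => β.mulTerm_add_left _ _ _ _ _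

theorem zero_mul (f : Arrow G →₀ A) : β.mul 0 f = 0 := Finsupp.sum_zero_index

theorem mul_zero (f : Arrow G →₀ A) : β.mul f 0 = 0 := by simp [mul]

theorem single_mul_single (t : Arrow G) (a : A) (v : Arrow G) (b : A) :
    β.mul (Finsupp.single t a) (Finsupp.single v b) = β.mulTerm t a v b := by
  unfold mul
  rw [Finsupp.sum_single_index, Finsupp.sum_single_index]
  · exact β.mulTerm_zero_right _ _ _
  · simp [mulTerm_zero_left]

theorem mulTerm_of_composable (t : Arrow G) (a : A) (v : Arrow G) (b : A)
    (h : Mor.Composable t v) :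
    β.mulTerm t a v b = Finsupp.single (Mor.comp t v h) (a * β.hom t b) := dif_pos h

theorem mulTerm_of_not (t : Arrow G) (a : A) (v : Arrow G) (b : A)
    (h : ¬Mor.Composable t v) : β.mulTerm t a v b = 0 := dif_neg h

theorem mul_assoc (f g h : Arrow G →₀ A) : β.mul (β.mul f g) h = β.mul f (β.mul g h) := by
  induction f using Finsupp.induction_linear with
  | zero => simp only [zero_mul]
  | add f f' h1 h2 => simp only [add_mul, h1, h2]
  | single t a =>
  induction g using Finsupp.induction_linear with
  | zero => simp only [zero_mul, mul_zero]
  | add f f' h1 h2 => simp only [add_mul, mul_add, h1, h2]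
  | single v b =>
  induction h using Finsupp.induction_linear with
  | zero => simp only [mul_zero]
  | add f f' h1 h2 => simp only [mul_add, h1, h2]
  | single w c =>
  by_cases h1 : Mor.Composable t v
  · by_cases h2 : Mor.Composable v w
    · rw [single_mul_single, single_mul_single, β.mulTerm_of_composable _ _ _ _ h1,
        β.mulTerm_of_composable _ _ _ _ h2, single_mul_single, single_mul_single,
        β.mulTerm_of_composable (Mor.comp t v h1) _ _ _ h2,
        β.mulTerm_of_composable t _ (Mor.comp v w h2) _ h1, Mor.comp_assoc _ _ _ h1 h2,
        β.hom_comp_apply, map_mul, _root_.mul_assoc]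
    · rw [single_mul_single, single_mul_single, β.mulTerm_of_composable _ _ _ _ h1,
        β.mulTerm_of_not _ _ _ _ h2, single_mul_single, mul_zero,
        β.mulTerm_of_not (Mor.comp t v h1) _ _ _ h2]
  · by_cases h2 : Mor.Composable v w
    · rw [single_mul_single, single_mul_single, β.mulTerm_of_not _ _ _ _ h1,
        β.mulTerm_of_composable _ _ _ _ h2, single_mul_single, zero_mul,
        β.mulTerm_of_not t _ (Mor.comp v w h2) _ h1]
    · rw [single_mul_single, single_mul_single, β.mulTerm_of_not _ _ _ _ h1,
        β.mulTerm_of_not _ _ _ _ h2, zero_mul, mul_zero]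

theorem smul_mul (c : ℂ) (f g : Arrow G →₀ A) : β.mul (c • f) g = c • β.mul f g := by
  induction f using Finsupp.induction_linear with
  | zero => simp only [zero_mul, smul_zero]
  | add f f' h1 h2 => simp only [add_mul, smul_add, h1, h2]
  | single t a =>
  induction g using Finsupp.induction_linear with
  | zero => simp only [mul_zero, smul_zero]
  | add f f' h1 h2 => simp only [mul_add, smul_add, h1, h2]
  | single v b =>
  rw [Finsupp.smul_single, single_mul_single, single_mul_single]
  unfold mulTerm
  split_ifs
  · rw [Finsupp.smul_single, smul_mul_assoc]
  · rw [smul_zero]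

theorem mul_smul (c : ℂ) (f g : Arrow G →₀ A) : β.mul f (c • g) = c • β.mul f g := by
  induction f using Finsupp.induction_linear with
  | zero => simp only [zero_mul, smul_zero]
  | add f f' h1 h2 => simp only [add_mul, smul_add, h1, h2]
  | single t a =>
  induction g using Finsupp.induction_linear with
  | zero => simp only [mul_zero, smul_zero]
  | add f f' h1 h2 => simp only [mul_add, smul_add, h1, h2]
  | single v b =>
  rw [Finsupp.smul_single, single_mul_single, single_mul_single]
  unfold mulTerm
  split_ifs
  · rw [map_smul, Finsupp.smul_single, mul_smul_comm]
  · rw [smul_zero]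

theorem adjoint_zero : β.adjoint 0 = 0 := Finsupp.sum_zero_index

theorem adjoint_add (f g : Arrow G →₀ A) : β.adjoint (f + g) = β.adjoint f + β.adjoint g :=
  Finsupp.sum_add_index' (fun t => by simp) fun t a b => by simp

theorem adjoint_single (t : Arrow G) (a : A) :
    β.adjoint (Finsupp.single t a) =
      Finsupp.single (Mor.inv t) (β.hom (Mor.inv t) (star a)) :=
  Finsupp.sum_single_index (by simp)

theorem adjoint_smul (c : ℂ) (f : Arrow G →₀ A) : β.adjoint (c • f) = star c • β.adjoint f := by
  induction f using Finsupp.induction_linear with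
  | zero => simp only [adjoint_zero, smul_zero]
  | add f f' h1 h2 => simp only [adjoint_add, smul_add, h1, h2]
  | single t a => rw [Finsupp.smul_single, adjoint_single, adjoint_single, star_smul, map_smul,
      Finsupp.smul_single]

/-- The space `A[G]` of all finite sums `∑ a_t t` with `a_t ∈ D (β_{t⁻¹})` for each `t`. -/
def algebraSubmodule : Submodule ℂ (Arrow G →₀ A) where
  carrier := {f | ∀ t, f t ∈ β.dom (Mor.inv t)}
  add_mem' hf hg t := add_mem (hf t) (hg t)
  zero_mem' t := zero_mem (β.dom (Mor.inv t))
  smul_mem' c _ hf t := SMulMemClass.smul_mem c (hf t)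

theorem single_mem {t : Arrow G} {a : A} (ha : a ∈ β.dom (Mor.inv t)) :
    Finsupp.single t a ∈ β.algebraSubmodule := by
  classical
  intro s
  rw [Finsupp.single_apply]
  split_ifs with h
  · rwa [← h]
  · exact zero_mem (β.dom (Mor.inv s))

theorem mem_induction {q : (Arrow G →₀ A) → Prop} (h0 : q 0)
    (ha : ∀ f g, q f → q g → q (f + g))
    (hs : ∀ t a, a ∈ β.dom (Mor.inv t) → q (Finsupp.single t a)) (f : Arrow G →₀ A)
    (hf : f ∈ β.algebraSubmodule) : q f := by
  rw [← f.sum_single]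
  exact Finset.sum_induction _ q ha h0 fun t _ => hs t _ (hf t)

theorem mul_mem {f g : Arrow G →₀ A} (hf : f ∈ β.algebraSubmodule) :
    β.mul f g ∈ β.algebraSubmodule := by
  refine Submodule.sum_mem _ fun t _ => Submodule.sum_mem _ fun v _ => ?_
  change β.mulTerm t (f t) v (g v) ∈ _
  unfold mulTerm
  split_ifs with h
  · refine β.single_mem ?_
    rw [β.dom_eq (s := Mor.inv (Mor.comp t v h)) (t := Mor.inv t) rfl]
    exact MulMemClass.mul_mem (hf t) (β.hom_mem t _)
  · exact zero_mem _

theorem adjoint_mem (f : Arrow G →₀ A) : β.adjoint f ∈ β.algebraSubmodule :=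
  Submodule.sum_mem _ fun _ _ => β.single_mem (β.hom_mem _ _)

theorem adjoint_adjoint (f : Arrow G →₀ A) (hf : f ∈ β.algebraSubmodule) :
    β.adjoint (β.adjoint f) = f := by
  refine β.mem_induction (q := fun f => β.adjoint (β.adjoint f) = f) ?_ ?_ ?_ f hf
  · simp only [adjoint_zero]
  · intro f g h1 h2
    simp only [adjoint_add, h1, h2]
  · intro t a ha
    rw [adjoint_single, adjoint_single, Mor.inv_inv, ← map_star (β.hom (Mor.inv t)), star_star,
      β.hom_hom_inv t ha]

theorem adjoint_mul (f g : Arrow G →₀ A) (hf : f ∈ β.algebraSubmodule)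
    (hg : g ∈ β.algebraSubmodule) :
    β.adjoint (β.mul f g) = β.mul (β.adjoint g) (β.adjoint f) := by
  refine β.mem_induction
    (q := fun f => β.adjoint (β.mul f g) = β.mul (β.adjoint g) (β.adjoint f)) ?_ ?_ ?_ f hf
  · simp only [adjoint_zero, zero_mul, mul_zero]
  · intro f f' h1 h2
    simp only [adjoint_add, add_mul, mul_add, h1, h2]
  intro t a ha
  refine β.mem_induction (q := fun g => β.adjoint (β.mul (Finsupp.single t a) g) =
    β.mul (β.adjoint g) (β.adjoint (Finsupp.single t a))) ?_ ?_ ?_ g hg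
  · simp only [adjoint_zero, zero_mul, mul_zero]
  · intro f f' h1 h2
    simp only [adjoint_add, add_mul, mul_add, h1, h2]
  intro v b hb
  rw [single_mul_single, adjoint_single, adjoint_single, single_mul_single]
  by_cases h : Mor.Composable t v
  · have hb' : star b ∈ β.dom t := by
      rw [β.dom_eq (s := t) (t := Mor.inv v) h]
      exact star_mem hb
    rw [β.mulTerm_of_composable _ _ _ _ h, adjoint_single,
      β.mulTerm_of_composable _ _ _ _ (Mor.composable_inv.2 h), Mor.inv_comp_rev t v h,
      β.hom_comp_apply, star_mul, map_mul, map_mul, ← map_star (β.hom t), β.hom_inv_hom t hb']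
  · rw [β.mulTerm_of_not _ _ _ _ h, adjoint_zero,
      β.mulTerm_of_not _ _ _ _ (fun h' => h (Mor.composable_inv.1 h'))]

/-- The *-algebra `A[G]`. -/
def Alg : Type u := β.algebraSubmodule

namespace Alg

instance : AddCommGroup β.Alg := inferInstanceAs (AddCommGroup β.algebraSubmodule)
instance : Module ℂ β.Alg := inferInstanceAs (Module ℂ β.algebraSubmodule)

variable {β} in
/-- The underlying finitely supported function. -/
def coe (f : β.Alg) : Arrow G →₀ A := (show β.algebraSubmodule from f).1

theorem coe_inj {f g : β.Alg} (h : coe f = coe g) : f = g := Subtype.ext h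

instance : Mul β.Alg := ⟨fun f g => ⟨β.mul (coe f) (coe g), β.mul_mem f.2⟩⟩
instance : Star β.Alg := ⟨fun f => ⟨β.adjoint (coe f), β.adjoint_mem _⟩⟩

theorem coe_mul (f g : β.Alg) : coe (f * g) = β.mul (coe f) (coe g) := rfl
theorem coe_star (f : β.Alg) : coe (star f) = β.adjoint (coe f) := rfl
theorem coe_add (f g : β.Alg) : coe (f + g) = coe f + coe g := rfl
theorem coe_zero : coe (0 : β.Alg) = 0 := rfl
theorem coe_smul (c : ℂ) (f : β.Alg) : coe (c • f) = c • coe f := rfl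
theorem coe_mem (f : β.Alg) : coe f ∈ β.algebraSubmodule := f.2

instance : NonUnitalRing β.Alg where
  left_distrib f g h := coe_inj β (by simp only [coe_mul, coe_add, β.mul_add])
  right_distrib f g h := coe_inj β (by simp only [coe_mul, coe_add, β.add_mul])
  zero_mul f := coe_inj β (by simp only [coe_mul, coe_zero, β.zero_mul])
  mul_zero f := coe_inj β (by simp only [coe_mul, coe_zero, β.mul_zero])
  mul_assoc f g h := coe_inj β (by simp only [coe_mul, β.mul_assoc])

instance : StarRing β.Alg where
  star_involutive f := coe_inj β (β.adjoint_adjoint _ (coe_mem β f))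
  star_mul f g := coe_inj β (β.adjoint_mul _ _ (coe_mem β f) (coe_mem β g))
  star_add f g := coe_inj β (β.adjoint_add (coe f) (coe g))

instance : IsScalarTower ℂ β.Alg β.Alg :=
  ⟨fun c f g => coe_inj β (β.smul_mul c (coe f) (coe g))⟩
instance : SMulCommClass ℂ β.Alg β.Alg :=
  ⟨fun c f g => coe_inj β (β.mul_smul c (coe f) (coe g)).symm⟩
instance : StarModule ℂ β.Alg := ⟨fun c f => coe_inj β (β.adjoint_smul c (coe f))⟩

end Alg

/-! #### The crossed product -/

/-- The C*-seminorms `f ↦ ‖σ f‖` on `A[G]`, for `σ` an `ℓ¹`-contractive *-representation of `A[G]`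
on a Hilbert space. -/
def repSeminorms : Set (β.Alg → ℝ) :=
  {p | ∃ (E : Type u) (_ : NormedAddCommGroup E) (_ : InnerProductSpace ℂ E)
    (_ : CompleteSpace E) (σ : β.Alg →⋆ₙₐ[ℂ] (E →L[ℂ] E)),
    (∀ f, ‖σ f‖ ≤ l1Norm (Alg.coe f)) ∧ p = fun f => ‖σ f‖}

theorem l1Norm_nonneg (f : Arrow G →₀ A) : 0 ≤ l1Norm f :=
  Finset.sum_nonneg fun _ _ => norm_nonneg _

theorem repSeminorms_nonempty : β.repSeminorms.Nonempty :=
  ⟨_, EuclideanSpace ℂ PEmpty.{u + 1}, inferInstance, inferInstance, inferInstance, 0,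
    fun f => by simpa using l1Norm_nonneg (Alg.coe f), rfl⟩

/-- The norm `‖f‖ = sup ‖σ f‖` on `A[G]`, where `σ` runs over all `ℓ¹`-contractive
*-representations of `A[G]`. -/
def crossedNorm (f : β.Alg) : ℝ := ⨆ p : β.repSeminorms, p.1 f

theorem isCStarSeminorm_crossedNorm : IsCStarSeminorm β.crossedNorm :=
  IsCStarSeminorm.iSup β.repSeminorms_nonempty
    (by rintro _ ⟨E, _, _, _, σ, -, rfl⟩; exact IsCStarSeminorm.ofHom σ)
    fun f => ⟨l1Norm (Alg.coe f), by rintro _ ⟨E, _, _, _, σ, hσ, rfl⟩; exact hσ f⟩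

/-- The crossed product `A ×_β G`, the enveloping C*-algebra of `A[G]`. -/
def CrossedProduct : Type u := CStarCompletion β.isCStarSeminorm_crossedNorm

instance : NonUnitalCStarAlgebra β.CrossedProduct :=
  inferInstanceAs (NonUnitalCStarAlgebra (CStarCompletion β.isCStarSeminorm_crossedNorm))

end QuasiAction

end CrossedProducts

/-! ### Actions of groupoids on small categories -/

section Actions

/-- A left action of a groupoid `G` on a small category `H`, with respect to a surjective map `φ`
from the objects of `H` to the objects of `G`.  The element `α_g(h)` is defined exactly if the
source of `g` is `φ` of the target and of the source of `h`.  Objects are identified with the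
corresponding units. -/
structure GroupoidAction (G H : Type u) [Groupoid.{u} G] [Category.{u} H] where
  /-- the map from the objects of `H` to the objects of `G` -/
  φ : H → G
  φ_surjective : Function.Surjective φ
  /-- the element `α_g(h)` -/
  act : ∀ (g : Arrow G) (h : Arrow H), g.left = φ h.right ∧ g.left = φ h.left → Arrow H
  act_source : ∀ g h (hd : g.left = φ h.right ∧ g.left = φ h.left),
    act g (Mor.unit h.left) ⟨hd.2, hd.2⟩ = Mor.unit (act g h hd).left
  act_target : ∀ g h (hd : g.left = φ h.right ∧ g.left = φ h.left),
    act g (Mor.unit h.right) ⟨hd.1, hd.1⟩ = Mor.unit (act g h hd).right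
  φ_act : ∀ (g : Arrow G) (u : H) (hu : g.left = φ u),
    φ (act g (Mor.unit u) ⟨hu, hu⟩).left = g.right
  unit_act : ∀ (h : Arrow H) (hd : φ h.right = φ h.left),
    act (Mor.unit (φ h.right)) h ⟨rfl, hd⟩ = h
  act_act : ∀ (g' g : Arrow G) (hg : Mor.Composable g' g) (h : Arrow H)
    (hd : g.left = φ h.right ∧ g.left = φ h.left),
    ∃ hd', act g' (act g h hd) hd' = act (Mor.comp g' g hg) h hd
  act_comp : ∀ (g : Arrow G) (h' h : Arrow H) (hh : Mor.Composable h' h)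
    (hd' : g.left = φ h'.right ∧ g.left = φ h'.left)
    (hd : g.left = φ h.right ∧ g.left = φ h.left),
    ∃ hc, act g (Mor.comp h' h hh) ⟨hd'.1, hd.2⟩ = Mor.comp (act g h' hd') (act g h hd) hc

namespace GroupoidAction

variable {G H : Type u} [Groupoid.{u} G] [Category.{u} H] (α : GroupoidAction G H)

/-- The action is regular: `φ` takes the same value at the source and the target of each
morphism of `H`. -/
def IsRegular : Prop := ∀ h : Arrow H, α.φ h.left = α.φ h.right

/-- `h` belongs to the domain of `α_g`, that is, to `H^g`. -/
def Dom (g : Arrow G) (h : Arrow H) : Prop := g.left = α.φ h.right ∧ g.left = α.φ h.left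

theorem φ_act_right (g : Arrow G) (h : Arrow H) (hd : α.Dom g h) :
    α.φ (α.act g h hd).right = g.right := by
  have h1 := α.φ_act g h.right hd.1
  rwa [α.act_target g h hd] at h1

theorem φ_act_left (g : Arrow G) (h : Arrow H) (hd : α.Dom g h) :
    α.φ (α.act g h hd).left = g.right := by
  have h1 := α.φ_act g h.left hd.2
  rwa [α.act_source g h hd] at h1

theorem dom_act {g g' : Arrow G} (hg : Mor.Composable g' g) {h : Arrow H} (hd : α.Dom g h) :
    α.Dom g' (α.act g h hd) :=
  ⟨Eq.trans hg (α.φ_act_right g h hd).symm, Eq.trans hg (α.φ_act_left g h hd).symm⟩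

theorem act_congr {g g' : Arrow G} {h h' : Arrow H} (hg : g = g') (hh : h = h')
    (hd : α.Dom g h) (hd' : α.Dom g' h') : α.act g h hd = α.act g' h' hd' := by
  subst hg; subst hh; rfl

theorem act_inv_act {g : Arrow G} {h : Arrow H} (hd : α.Dom g h) :
    α.act (Mor.inv g) (α.act g h hd) (α.dom_act (Mor.composable_inv_self g) hd) = h := by
  obtain ⟨h1, h2⟩ := α.act_act (Mor.inv g) g (Mor.composable_inv_self g) h hd
  refine h2.trans (Eq.trans (α.act_congr ?_ rfl _ ⟨rfl, ?_⟩) (α.unit_act h ?_))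
  · rw [Mor.inv_comp, hd.1]
  all_goals exact hd.1.symm.trans hd.2

theorem composable_act {g : Arrow G} {h' h : Arrow H} (hd' : α.Dom g h') (hd : α.Dom g h)
    (hc : Mor.Composable h' h) : Mor.Composable (α.act g h' hd') (α.act g h hd) := by
  have h1 := α.act_source g h' hd'
  have h2 := α.act_congr (g := g) rfl (congrArg Mor.unit hc) ⟨hd'.2, hd'.2⟩ ⟨hd.1, hd.1⟩
  exact congrArg (fun f : Arrow H => f.left) (h1.symm.trans (h2.trans (α.act_target g h hd)))

theorem composable_act_iff {g : Arrow G} {h' h : Arrow H} (hd' : α.Dom g h') (hd : α.Dom g h) :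
    Mor.Composable (α.act g h' hd') (α.act g h hd) ↔ Mor.Composable h' h := by
  refine ⟨fun hc => ?_, α.composable_act hd' hd⟩
  have := α.composable_act (g := Mor.inv g) (α.dom_act (Mor.composable_inv_self g) hd')
    (α.dom_act (Mor.composable_inv_self g) hd) hc
  rwa [act_inv_act, act_inv_act] at this

variable {α}

theorem IsRegular.dom_iff (hα : α.IsRegular) {g : Arrow G} {h : Arrow H} :
    α.Dom g h ↔ g.left = α.φ h.right :=
  ⟨fun hd => hd.1, fun hd => ⟨hd, hd.trans (hα h).symm⟩⟩

theorem IsRegular.dom_of_composable (hα : α.IsRegular) {g : Arrow G} {h' h : Arrow H}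
    (hc : Mor.Composable h' h) : α.Dom g h' ↔ α.Dom g h := by
  rw [hα.dom_iff, hα.dom_iff, ← hα h', show h'.left = h.right from hc]

theorem IsRegular.intersect_act (hα : α.IsRegular) {g : Arrow G} {h h' : Arrow H}
    (hd : α.Dom g h) (hd' : α.Dom g h') (hi : Mor.Intersect h h') :
    Mor.Intersect (α.act g h hd) (α.act g h' hd') := by
  obtain ⟨k, k', hk, hk', he⟩ := hi
  obtain ⟨h1, h2⟩ := α.act_comp g h k hk hd ((hα.dom_of_composable hk).1 hd)
  obtain ⟨h3, h4⟩ := α.act_comp g h' k' hk' hd' ((hα.dom_of_composable hk').1 hd')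
  refine ⟨_, _, h1, h3, h2.symm.trans (Eq.trans ?_ h4)⟩
  exact α.act_congr rfl he _ _

theorem IsRegular.disjoint_act (hα : α.IsRegular) {g : Arrow G} {h h' : Arrow H}
    (hd : α.Dom g h) (hd' : α.Dom g h') (hi : Mor.Disjoint h h') :
    Mor.Disjoint (α.act g h hd) (α.act g h' hd') := fun h1 => hi (by
  have := hα.intersect_act (g := Mor.inv g) (α.dom_act (Mor.composable_inv_self g) hd)
    (α.dom_act (Mor.composable_inv_self g) hd') h1
  rwa [act_inv_act, act_inv_act] at this)

/-! #### The quasi-action on `C*(H)` -/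

open Classical in
variable (α) in
/-- The map `h ↦ S (α_g(h))` for `h ∈ H^g`, and `h ↦ 0` otherwise. -/
def tildeRep (g : Arrow G) (h : Arrow H) : CatCStar H :=
  if hd : α.Dom g h then CatCStar.S (α.act g h hd) else 0

theorem tildeRep_of_dom {g : Arrow G} {h : Arrow H} (hd : α.Dom g h) :
    α.tildeRep g h = CatCStar.S (α.act g h hd) := dif_pos hd

theorem tildeRep_of_not {g : Arrow G} {h : Arrow H} (hd : ¬α.Dom g h) :
    α.tildeRep g h = 0 := dif_neg hd

theorem IsRegular.isCatRepresentation_tildeRep (hα : α.IsRegular) (g : Arrow G) :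
    IsCatRepresentation (α.tildeRep g) := by
  have hS := CatCStar.isCatRepresentation_S (Λ := H)
  constructor
  · intro f
    by_cases hf : α.Dom g f
    · simp only [tildeRep_of_dom hf, hS.partialIsometry]
    · simp [tildeRep_of_not hf]
  · intro f k hc
    by_cases hf : α.Dom g f
    · have hk := (hα.dom_of_composable hc).1 hf
      obtain ⟨h1, h2⟩ := α.act_comp g f k hc hf hk
      rw [tildeRep_of_dom hf, tildeRep_of_dom hk, tildeRep_of_dom (h := Mor.comp f k hc) ⟨hf.1, hk.2⟩, h2,
        hS.mul_of_composable _ _ h1]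
    · have hk : ¬α.Dom g k := fun h => hf ((hα.dom_of_composable hc).2 h)
      have hfk : ¬α.Dom g (Mor.comp f k hc) := fun h => hf (hα.dom_iff.2 h.1)
      simp [tildeRep_of_not hf, tildeRep_of_not hfk]
  · intro f k hc
    by_cases hf : α.Dom g f
    · by_cases hk : α.Dom g k
      · rw [tildeRep_of_dom hf, tildeRep_of_dom hk]
        exact hS.mul_of_not_composable _ _ fun h => hc ((α.composable_act_iff hf hk).1 h)
      · simp [tildeRep_of_not hk]
    · simp [tildeRep_of_not hf]
  · intro f k
    by_cases hf : α.Dom g f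
    · by_cases hk : α.Dom g k
      · rw [tildeRep_of_dom hf, tildeRep_of_dom hk]
        exact hS.commute_initial _ _
      · simp [tildeRep_of_not hk]
    · simp [tildeRep_of_not hf]
  · intro f k
    by_cases hf : α.Dom g f
    · by_cases hk : α.Dom g k
      · rw [tildeRep_of_dom hf, tildeRep_of_dom hk]
        exact hS.commute_final _ _
      · simp [tildeRep_of_not hk]
    · simp [tildeRep_of_not hf]
  · intro f k
    by_cases hf : α.Dom g f
    · by_cases hk : α.Dom g k
      · rw [tildeRep_of_dom hf, tildeRep_of_dom hk]
        exact hS.commute_initial_final _ _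
      · simp [tildeRep_of_not hk]
    · simp [tildeRep_of_not hf]
  · intro f k hi
    by_cases hf : α.Dom g f
    · by_cases hk : α.Dom g k
      · rw [tildeRep_of_dom hf, tildeRep_of_dom hk]
        exact hS.final_mul_final _ _ (hα.disjoint_act hf hk hi)
      · simp [tildeRep_of_not hk]
    · simp [tildeRep_of_not hf]
  · intro f k hc
    by_cases hf : α.Dom g f
    · have hk := (hα.dom_of_composable hc).1 hf
      rw [tildeRep_of_dom hf, tildeRep_of_dom hk]
      exact hS.initial_mul_final _ _ (α.composable_act hf hk hc)
    · have hk : ¬α.Dom g k := fun h => hf ((hα.dom_of_composable hc).2 h)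
      simp [tildeRep_of_not hk]

/-- The *-endomorphism of `C*(H)` with `S h ↦ S (α_g(h))` for `h ∈ H^g`, and `S h ↦ 0` for the
other morphisms `h`. -/
def tildeHom (hα : α.IsRegular) (g : Arrow G) : CatCStar H →⋆ₙₐ[ℂ] CatCStar H :=
  CatCStar.lift (α.tildeRep g) (hα.isCatRepresentation_tildeRep g)

theorem tildeHom_S (hα : α.IsRegular) (g : Arrow G) (h : Arrow H) :
    tildeHom hα g (CatCStar.S h) = α.tildeRep g h := CatCStar.lift_S _ _ _

variable (α) in
/-- The closed *-subalgebra of `C*(H)` generated by the `S h` with `h ∈ H^g`. -/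
def tildeDom (g : Arrow G) : NonUnitalStarSubalgebra ℂ (CatCStar H) :=
  (NonUnitalStarAlgebra.adjoin ℂ (CatCStar.S '' {h | α.Dom g h})).topologicalClosure

theorem S_mem_tildeDom {g : Arrow G} {h : Arrow H} (hd : α.Dom g h) :
    CatCStar.S h ∈ α.tildeDom g :=
  NonUnitalStarSubalgebra.le_topologicalClosure _
    (NonUnitalStarAlgebra.subset_adjoin ℂ _ ⟨h, hd, rfl⟩)

theorem isClosed_tildeDom (g : Arrow G) : IsClosed (α.tildeDom g : Set (CatCStar H)) :=
  NonUnitalStarSubalgebra.isClosed_topologicalClosure _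

theorem tildeDom_eq {g g' : Arrow G} (h : g.left = g'.left) : α.tildeDom g = α.tildeDom g' := by
  unfold tildeDom Dom
  rw [h]

theorem eq_on_tildeDom {g : Arrow G} {φ ψ : CatCStar H →⋆ₙₐ[ℂ] CatCStar H}
    (h : ∀ k, α.Dom g k → φ (CatCStar.S k) = ψ (CatCStar.S k)) {a : CatCStar H}
    (ha : a ∈ α.tildeDom g) : φ a = ψ a := by
  have h1 : α.tildeDom g ≤ NonUnitalStarAlgHom.equalizer φ ψ := by
    refine NonUnitalStarSubalgebra.topologicalClosure_minimal _
      (NonUnitalStarAlgebra.adjoin_le ?_) 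
      (show IsClosed {x | φ x = ψ x} from isClosed_eq (map_continuous φ) (map_continuous ψ))
    rintro _ ⟨k, hk, rfl⟩
    exact h k hk
  exact h1 ha

theorem tildeHom_mem (hα : α.IsRegular) (g : Arrow G) (a : CatCStar H) :
    tildeHom hα g a ∈ α.tildeDom (Mor.inv g) := by
  refine CatCStar.mem_of_S ((α.tildeDom (Mor.inv g)).comap (tildeHom hα g))
    ((isClosed_tildeDom _).preimage (map_continuous (tildeHom hα g))) (fun h => ?_) a
  change tildeHom hα g (CatCStar.S h) ∈ α.tildeDom (Mor.inv g)
  rw [tildeHom_S]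
  by_cases hd : α.Dom g h
  · rw [tildeRep_of_dom hd]
    exact S_mem_tildeDom (α.dom_act (Mor.composable_inv_self g) hd)
  · rw [tildeRep_of_not hd]
    exact zero_mem _

theorem tildeHom_inv_hom (hα : α.IsRegular) (g : Arrow G) {a : CatCStar H}
    (ha : a ∈ α.tildeDom g) : tildeHom hα (Mor.inv g) (tildeHom hα g a) = a := by
  refine eq_on_tildeDom (φ := (tildeHom hα (Mor.inv g)).comp (tildeHom hα g))
    (ψ := NonUnitalStarAlgHom.id ℂ _) (fun k hk => ?_) ha
  change tildeHom hα (Mor.inv g) (tildeHom hα g (CatCStar.S k)) = CatCStar.S k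
  rw [tildeHom_S, tildeRep_of_dom hk, tildeHom_S,
    tildeRep_of_dom (α.dom_act (Mor.composable_inv_self g) hk), act_inv_act]

theorem tildeHom_hom_inv (hα : α.IsRegular) (g : Arrow G) {a : CatCStar H}
    (ha : a ∈ α.tildeDom (Mor.inv g)) : tildeHom hα g (tildeHom hα (Mor.inv g) a) = a := by
  have h := tildeHom_inv_hom hα (Mor.inv g) ha
  rwa [Mor.inv_inv] at h

variable (α) in
/-- The quasi-action `α̃` of `G` on `C*(H)` given by a regular action `α` of `G` on `H`. -/
def quasiAction (hα : α.IsRegular) : QuasiAction G (CatCStar H) where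
  hom := tildeHom hα
  dom := α.tildeDom
  isClosed_dom := isClosed_tildeDom
  bijOn g := by
    refine ⟨fun a _ => ⟨a, rfl⟩, fun a ha b hb hab => ?_, ?_⟩
    · rw [← tildeHom_inv_hom hα g ha, ← tildeHom_inv_hom hα g hb, hab]
    · rintro _ ⟨a, rfl⟩
      have h1 := tildeHom_mem hα (Mor.inv g) (tildeHom hα g a)
      rw [Mor.inv_inv] at h1
      exact ⟨_, h1, tildeHom_hom_inv hα g (tildeHom_mem hα g a)⟩
  range_eq_dom s t h := by
    rw [tildeDom_eq (g := s) (g' := Mor.inv t) h]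
    refine Set.Subset.antisymm ?_ fun a ha => ⟨_, tildeHom_hom_inv hα t ha⟩
    rintro _ ⟨a, rfl⟩
    exact tildeHom_mem hα t a
  dom_comp s t h := tildeDom_eq rfl
  hom_comp s t h := by
    refine CatCStar.hom_ext fun k => ?_
    change tildeHom hα _ (CatCStar.S k) = tildeHom hα s (tildeHom hα t (CatCStar.S k))
    rw [tildeHom_S, tildeHom_S]
    by_cases hd : α.Dom t k
    · obtain ⟨h1, h2⟩ := α.act_act s t h k hd
      rw [tildeRep_of_dom (g := Mor.comp s t h) hd, tildeRep_of_dom hd, tildeHom_S,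
        tildeRep_of_dom h1, h2]
    · rw [tildeRep_of_not (g := Mor.comp s t h) hd, tildeRep_of_not hd, map_zero]
  hom_comp_eq_zero s t h := by
    refine CatCStar.hom_ext fun k => ?_
    change tildeHom hα s (tildeHom hα t (CatCStar.S k)) = 0
    rw [tildeHom_S]
    by_cases hd : α.Dom t k
    · rw [tildeRep_of_dom hd, tildeHom_S, tildeRep_of_not]
      exact fun h1 => h (h1.1.trans (α.φ_act_right t k hd))
    · rw [tildeRep_of_not hd, map_zero]

end GroupoidAction

end Actions

/-! ### Restriction to a part of the unit space -/

section Restriction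

/-- A full subcategory of a groupoid is a groupoid. -/
instance fullSubcategoryGroupoid {G : Type u} [Groupoid.{u} G]
    (P : ObjectProperty G) : Groupoid.{u} P.FullSubcategory :=
  Groupoid.ofFullyFaithfulToGroupoid P.ι P.fullyFaithfulι

namespace Mor

variable {C : Type u} [Category.{u} C] {P : ObjectProperty C}

/-- A morphism of a full subcategory, as a morphism of the category. -/
def ofSub (f : Arrow P.FullSubcategory) : Arrow C := Arrow.mk (P.ι.map f.hom)

/-- A morphism whose source and target lie in a full subcategory, as a morphism of the
subcategory. -/
def toSub (f : Arrow C) (hl : P f.left) (hr : P f.right) : Arrow P.FullSubcategory :=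
  Arrow.mk (ObjectProperty.homMk f.hom : (⟨f.left, hl⟩ : P.FullSubcategory) ⟶ ⟨f.right, hr⟩)

theorem ofSub_toSub (f : Arrow C) (hl : P f.left) (hr : P f.right) :
    ofSub (toSub f hl hr) = f := rfl

theorem toSub_ofSub (f : Arrow P.FullSubcategory) :
    toSub (ofSub f) f.left.property f.right.property = f := rfl

theorem toSub_congr {f g : Arrow C} (h : f = g) (hl : P f.left) (hr : P f.right)
    (hl' : P g.left) (hr' : P g.right) : toSub f hl hr = toSub g hl' hr' := by
  subst h; rfl

theorem ofSub_injective {f g : Arrow P.FullSubcategory} (h : ofSub f = ofSub g) : f = g := by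
  rw [← toSub_ofSub f, ← toSub_ofSub g]
  exact toSub_congr h _ _ _ _

theorem composable_ofSub {f g : Arrow P.FullSubcategory} (h : Composable f g) :
    Composable (ofSub f) (ofSub g) :=
  congrArg ObjectProperty.FullSubcategory.obj h

theorem composable_of_ofSub {f g : Arrow P.FullSubcategory}
    (h : Composable (ofSub f) (ofSub g)) : Composable f g :=
  ObjectProperty.FullSubcategory.ext h

theorem ofSub_comp (f g : Arrow P.FullSubcategory) (h : Composable f g) :
    ofSub (comp f g h) = comp (ofSub f) (ofSub g) (composable_ofSub h) := by
  obtain ⟨a, b, f, rfl⟩ := exists_mk f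
  obtain ⟨c, d, g, rfl⟩ := exists_mk g
  cases h
  exact (congrArg ofSub (comp_mk f g rfl)).trans (comp_mk f.hom g.hom rfl).symm

theorem ofSub_unit (x : P.FullSubcategory) : ofSub (unit x) = unit x.obj := rfl

end Mor

namespace GroupoidAction

variable {G H : Type u} [Groupoid.{u} G] [Category.{u} H] (α : GroupoidAction G H)

/-- The part of `H` lying over a set `P` of units of `G`: the full subcategory on the objects `u`
with `φ(u) ∈ P`.  (If the action is regular, its morphisms are the morphisms `h` of `H` such that
`φ` of the source of `h` is in `P`.) -/
def lyingOver (P : ObjectProperty G) : ObjectProperty H := fun u => P (α.φ u)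

/-- The restriction of an action of `G` on `H` to an action of the full subgroupoid of `G` on a set
`P` of units on the part of `H` lying over `P`. -/
def restrict (P : ObjectProperty G) :
    GroupoidAction P.FullSubcategory (α.lyingOver P).FullSubcategory where
  φ u := ⟨α.φ u.obj, u.property⟩
  φ_surjective x := by
    obtain ⟨u, hu⟩ := α.φ_surjective x.obj
    exact ⟨⟨u, (congrArg P hu).mpr x.property⟩, ObjectProperty.FullSubcategory.ext hu⟩
  act g h hd :=
    have hd' : α.Dom (Mor.ofSub g) (Mor.ofSub h) :=
      ⟨congrArg ObjectProperty.FullSubcategory.obj hd.1,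
        congrArg ObjectProperty.FullSubcategory.obj hd.2⟩
    Mor.toSub (α.act (Mor.ofSub g) (Mor.ofSub h) hd')
      ((congrArg P (α.φ_act_left _ _ hd')).mpr g.right.property)
      ((congrArg P (α.φ_act_right _ _ hd')).mpr g.right.property)
  act_source g h hd := Mor.ofSub_injective (α.act_source (Mor.ofSub g) (Mor.ofSub h) _)
  act_target g h hd := Mor.ofSub_injective (α.act_target (Mor.ofSub g) (Mor.ofSub h) _)
  φ_act g u hu := ObjectProperty.FullSubcategory.ext (α.φ_act (Mor.ofSub g) u.obj
    (congrArg ObjectProperty.FullSubcategory.obj hu))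
  unit_act h hd := Mor.ofSub_injective (α.unit_act (Mor.ofSub h)
    (congrArg ObjectProperty.FullSubcategory.obj hd))
  act_act g' g hg h hd := by
    obtain ⟨h1, h2⟩ := α.act_act (Mor.ofSub g') (Mor.ofSub g) (Mor.composable_ofSub hg)
      (Mor.ofSub h) ⟨congrArg ObjectProperty.FullSubcategory.obj hd.1,
        congrArg ObjectProperty.FullSubcategory.obj hd.2⟩
    refine ⟨⟨ObjectProperty.FullSubcategory.ext h1.1, ObjectProperty.FullSubcategory.ext h1.2⟩,
      Mor.ofSub_injective (h2.trans ?_)⟩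
    exact α.act_congr (Mor.ofSub_comp g' g hg).symm rfl _ _
  act_comp g h' h hh hd' hd := by
    obtain ⟨h1, h2⟩ := α.act_comp (Mor.ofSub g) (Mor.ofSub h') (Mor.ofSub h)
      (Mor.composable_ofSub hh)
      ⟨congrArg ObjectProperty.FullSubcategory.obj hd'.1,
        congrArg ObjectProperty.FullSubcategory.obj hd'.2⟩
      ⟨congrArg ObjectProperty.FullSubcategory.obj hd.1,
        congrArg ObjectProperty.FullSubcategory.obj hd.2⟩
    refine ⟨Mor.composable_of_ofSub h1, Mor.ofSub_injective ?_⟩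
    refine Eq.trans ?_ (Mor.ofSub_comp _ _ _).symm
    exact (α.act_congr rfl (Mor.ofSub_comp h' h hh) _ _).trans h2

theorem IsRegular.restrict {α : GroupoidAction G H} (hα : α.IsRegular) (P : ObjectProperty G) :
    (α.restrict P).IsRegular := fun h =>
  ObjectProperty.FullSubcategory.ext (hα (Mor.ofSub h))

end GroupoidAction

end Restriction

/-! ### The groupoid of a group bundle -/

section Bundle

/-- The unit space `X` of the groupoid of the group bundle `(X, R, {Γ_ξ})`, where `R` is an
equivalence relation on `X` and `Γ` is a family of groups indexed by the classes of `R`. -/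
def GroupBundle {X : Type u} (R : Setoid X) (_Γ : Quotient R → Type u) : Type u := X

namespace GroupBundle

variable {X : Type u} {R : Setoid X} {Γ : Quotient R → Type u}

/-- The class of a unit. -/
def cls (x : GroupBundle R Γ) : Quotient R := Quotient.mk R x

/-- The elements `(x, g, y)` with source `y` and target `x`, where `x, y ∈ ξ` and `g ∈ Γ_ξ`. -/
structure Hom (y x : GroupBundle R Γ) : Type u where
  /-- the class -/
  ξ : Quotient R
  target_mem : cls x = ξ
  source_mem : cls y = ξ
  /-- the group element -/
  val : Γ ξ

/-- Transport along an equality of classes. -/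
def trans {a b : Quotient R} (h : a = b) (v : Γ a) : Γ b := h ▸ v

theorem trans_trans {a b c : Quotient R} (h : a = b) (h' : b = c) (v : Γ a) :
    trans h' (trans h v) = trans (h.trans h') v := by
  subst h; subst h'; rfl

variable [∀ ξ, Group (Γ ξ)]

theorem trans_mul {a b : Quotient R} (h : a = b) (v w : Γ a) :
    trans h (v * w) = trans h v * trans h w := by
  subst h; rfl

/-- `(x, g, y)(y, h, z) = (x, gh, z)`. -/
def Hom.mul {z y x : GroupBundle R Γ} (f : Hom y x) (k : Hom z y) : Hom z x where
  ξ := f.ξ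
  target_mem := f.target_mem
  source_mem := k.source_mem.trans (k.target_mem.symm.trans f.source_mem)
  val := f.val * trans (k.target_mem.symm.trans f.source_mem) k.val

/-- The groupoid of a group bundle, with `(x, g, y)(y, h, z) = (x, gh, z)`. -/
instance : Groupoid.{u} (GroupBundle R Γ) where
  Hom y x := Hom y x
  id x := ⟨cls x, rfl, rfl, 1⟩
  comp k f := f.mul k
  inv f := ⟨f.ξ, f.source_mem, f.target_mem, f.val⁻¹⟩
  id_comp f := by
    obtain ⟨ξ, h1, h2, v⟩ := f
    subst h2
    simp [Hom.mul, trans]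
  comp_id f := by
    obtain ⟨ξ, h1, h2, v⟩ := f
    subst h1
    simp [Hom.mul, trans]
  assoc f g k := by
    refine congrArg (Hom.mk _ _ _) ?_
    exact (congrArg (k.val * ·) ((trans_mul _ _ _).trans
      (congrArg (trans _ g.val * ·) (trans_trans _ _ _)))).trans (mul_assoc _ _ _).symm
  inv_comp f := by
    obtain ⟨ξ, h1, h2, v⟩ := f
    subst h1
    simp [Hom.mul, trans]
  comp_inv f := by
    obtain ⟨ξ, h1, h2, v⟩ := f
    subst h2
    simp [Hom.mul, trans]

/-- For a groupoid `G` that is isomorphic to the groupoid of a group bundle: the units of `G` that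
correspond to the elements of the class `ξ`. -/
def part {G : Type u} [Groupoid.{u} G] (θ : Grpd.of G ≅ Grpd.of (GroupBundle R Γ))
    (ξ : Quotient R) : ObjectProperty G :=
  fun x => cls (Γ := Γ) ((θ.hom : G ⥤ GroupBundle R Γ).obj x) = ξ

end GroupBundle

end Bundle

/-! ### The `c₀`-direct sum -/

section DirectSum

/-- The `c₀`-direct sum of a family of C*-algebras: the families `(a_i)` such that for each `ε > 0`
one has `‖a_i‖ < ε` for all `i` outside of a finite set. -/
def c0Sum {I : Type u} (A : I → Type u) [∀ i, NonUnitalCStarAlgebra (A i)] :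
    NonUnitalStarSubalgebra ℂ (∀ i, A i) where
  carrier := {a | ∀ ε > 0, ∃ F : Finset I, ∀ i, i ∉ F → ‖a i‖ < ε}
  add_mem' {a b} ha hb ε hε := by
    classical
    obtain ⟨F, hF⟩ := ha (ε / 2) (half_pos hε)
    obtain ⟨F', hF'⟩ := hb (ε / 2) (half_pos hε)
    refine ⟨F ∪ F', fun i hi => ?_⟩
    rw [Finset.mem_union, not_or] at hi
    have := norm_add_le (a i) (b i)
    have h1 := hF i hi.1
    have h2 := hF' i hi.2
    change ‖a i + b i‖ < ε
    linarith
  zero_mem' ε hε := ⟨∅, fun i _ => by simpa using hε⟩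
  mul_mem' {a b} ha hb ε hε := by
    classical
    obtain ⟨F, hF⟩ := ha ε hε
    obtain ⟨F', hF'⟩ := hb 1 one_pos
    refine ⟨F ∪ F', fun i hi => ?_⟩
    rw [Finset.mem_union, not_or] at hi
    have h1 := hF i hi.1
    have h2 := hF' i hi.2
    change ‖a i * b i‖ < ε
    have h3 := norm_mul_le (a i) (b i)
    have h4 := mul_le_mul_of_nonneg_left h2.le (norm_nonneg (a i))
    linarith
  smul_mem' c a ha ε hε := by
    obtain ⟨F, hF⟩ := ha (ε / (‖c‖ + 1)) (div_pos hε (by positivity))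
    refine ⟨F, fun i hi => ?_⟩
    have h1 := hF i hi
    rw [lt_div_iff₀ (by positivity)] at h1
    change ‖c • a i‖ < ε
    rw [norm_smul]
    have := norm_nonneg (a i)
    nlinarith
  star_mem' {a} ha ε hε := by
    obtain ⟨F, hF⟩ := ha ε hε
    exact ⟨F, fun i hi => by simpa using hF i hi⟩

end DirectSum

end

/-!
The classes of a group bundle partition the units of `G` into sets `P_ξ` that no element of `G`
leaves, and by regularity `H` splits along with them.  So there are equivariant *-homomorphisms
`C*(H_ξ) → C*(H)` (`inclHom`) and `C*(H) → C*(H_ξ)` (`restrictHom`, which kills the generators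
outside of `H_ξ`), whose composite on `C*(H_ξ)` is the identity.  Because representations of a
convolution algebra pull back along `ℓ¹`-contractive *-homomorphisms, both induce *-homomorphisms
`Ψ_ξ` (`inclCrossed`) and `Φ_ξ` (`restrictCrossed`) of the crossed products.  On monomials one sees
that `Φ_ξ Ψ_ξ = 1`, that `Φ_η Ψ_ξ = 0` and that the ranges of `Ψ_ξ` and `Ψ_η` are orthogonal for
`ξ ≠ η`, and that each monomial lies in the range of one of the `Ψ_ξ`.

It remains to recognize the `c₀`-direct sum (`nonempty_starAlgEquiv_c0Sum`), by showing that
`a ↦ (Φ_ξ(a))` is a bijection onto it.  Its values vanish at infinity since they do on a dense set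
and the `Φ_ξ` are contractive.  It is injective because `Ψ_ξ(b) a = Ψ_ξ(b Φ_ξ(a))`, so that an
element of the kernel is annihilated by a dense set.  It is surjective because `∑ Ψ_ξ(b_ξ)`
converges for `(b_ξ)` in the `c₀`-direct sum: the finite partial sums are values of
*-homomorphisms on finite products of C*-algebras, hence are bounded by `max ‖b_ξ‖`.
-/

noncomputable section

/-! ### Recognizing a `c₀`-direct sum -/

section Recognition

variable {I A : Type u} {B : I → Type u} [NonUnitalCStarAlgebra A]
  [∀ i, NonUnitalCStarAlgebra (B i)]

/-- The sum `(b_i) ↦ ∑ Ψ_i(b_i)` of finitely many *-homomorphisms with mutually orthogonal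
ranges. -/
def orthogonalSum (Ψ : ∀ i, B i →⋆ₙₐ[ℂ] A)
    (hΨ : ∀ i j, i ≠ j → ∀ b c, Ψ i b * Ψ j c = 0) (F : Finset I) :
    (∀ i : F, B i) →⋆ₙₐ[ℂ] A where
  toFun b := ∑ i : F, Ψ i (b i)
  map_smul' c b := by simp [Finset.smul_sum]
  map_zero' := by simp
  map_add' b c := by simp [Finset.sum_add_distrib]
  map_mul' b c := by
    rw [Finset.sum_mul_sum]
    refine Finset.sum_congr rfl fun i _ => ?_
    rw [Finset.sum_eq_single i (fun j _ hj => hΨ _ _ (fun h => hj (Subtype.ext h.symm)) _ _)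
      (fun h => absurd (Finset.mem_univ i) h), Pi.mul_apply, map_mul]
  map_star' b := by simp [star_sum, map_star]

/-- The norm of a finite sum of mutually orthogonal elements is at most the largest of their norms:
`orthogonalSum` is a *-homomorphism on a finite product of C*-algebras, hence contractive. -/
theorem norm_sum_orthogonal_le (Ψ : ∀ i, B i →⋆ₙₐ[ℂ] A)
    (hΨ : ∀ i j, i ≠ j → ∀ b c, Ψ i b * Ψ j c = 0) (F : Finset I) (b : ∀ i, B i) {r : ℝ}
    (hr : 0 ≤ r) (hb : ∀ i ∈ F, ‖b i‖ ≤ r) : ‖∑ i ∈ F, Ψ i (b i)‖ ≤ r := by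
  have h := NonUnitalStarAlgHom.norm_apply_le (orthogonalSum Ψ hΨ F) fun i : F => b i
  rw [← Finset.sum_coe_sort]
  exact h.trans ((pi_norm_le_iff_of_nonneg hr).2 fun i => hb i i.2)

theorem summable_orthogonal (Ψ : ∀ i, B i →⋆ₙₐ[ℂ] A)
    (hΨ : ∀ i j, i ≠ j → ∀ b c, Ψ i b * Ψ j c = 0) (b : ∀ i, B i) (hb : b ∈ c0Sum B) :
    Summable fun i => Ψ i (b i) := by
  refine summable_iff_vanishing_norm.2 fun ε hε => ?_
  obtain ⟨F, hF⟩ := hb (ε / 2) (half_pos hε)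
  refine ⟨F, fun t ht => lt_of_le_of_lt ?_ (half_lt_self hε)⟩
  exact norm_sum_orthogonal_le Ψ hΨ t b (half_pos hε).le fun i hi =>
    (hF i (Finset.disjoint_left.1 ht hi)).le

/-- If the ranges of the `Ψ_i` span a dense subspace and `Φ_j Ψ_i = 0` for `i ≠ j`, then the values
of the `Φ_i` vanish at infinity. -/
theorem mem_c0Sum_of_dense (Φ : ∀ i, A →⋆ₙₐ[ℂ] B i) (Ψ : ∀ i, B i →⋆ₙₐ[ℂ] A)
    (hΦΨ_ne : ∀ i j, i ≠ j → ∀ b, Φ j (Ψ i b) = 0)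
    (hd : Dense (AddSubmonoid.closure (⋃ i, Set.range (Ψ i)) : Set A)) (a : A) :
    (fun i => Φ i a) ∈ c0Sum B := by
  have h1 : ∀ x ∈ AddSubmonoid.closure (⋃ i, Set.range (Ψ i)),
      (fun i => Φ i x) ∈ c0Sum B := fun x hx => by
    induction hx using AddSubmonoid.closure_induction with
    | mem x hx =>
      obtain ⟨i, b, rfl⟩ := Set.mem_iUnion.1 hx
      refine fun ε hε => ⟨{i}, fun j hj => ?_⟩
      rw [Finset.mem_singleton] at hj
      simpa [hΦΨ_ne i j (Ne.symm hj)] using hε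
    | zero =>
      rw [show (fun i => Φ i 0) = 0 from funext fun i => map_zero (Φ i)]
      exact zero_mem _
    | add x y _ _ hx hy =>
      rw [show (fun i => Φ i (x + y)) = (fun i => Φ i x) + fun i => Φ i y from
        funext fun i => map_add (Φ i) x y]
      exact add_mem hx hy
  intro ε hε
  obtain ⟨x, hx, hax⟩ := Metric.mem_closure_iff.1 (hd a) (ε / 2) (half_pos hε)
  obtain ⟨F, hF⟩ := h1 x hx (ε / 2) (half_pos hε)
  refine ⟨F, fun i hi => ?_⟩
  have h2 : ‖Φ i (a - x)‖ ≤ ‖a - x‖ := NonUnitalStarAlgHom.norm_apply_le (Φ i) (a - x)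
  have h3 : ‖Φ i a‖ ≤ ‖Φ i (a - x)‖ + ‖Φ i x‖ := by
    simpa using norm_add_le (Φ i (a - x)) (Φ i x)
  rw [dist_eq_norm] at hax
  have h4 : ‖Φ i x‖ < ε / 2 := hF i hi
  linarith

/-- The intersection of the kernels of the `Φ_i` is `0`: an element `a` of it satisfies
`Ψ_i(b) a = Ψ_i(b Φ_i(a)) = 0` for all `i` and `b`, so it is annihilated by a dense set. -/
theorem eq_zero_of_forall_apply_eq_zero (Φ : ∀ i, A →⋆ₙₐ[ℂ] B i) (Ψ : ∀ i, B i →⋆ₙₐ[ℂ] A)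
    (hΦΨ : ∀ i b, Φ i (Ψ i b) = b) (hΦΨ_ne : ∀ i j, i ≠ j → ∀ b, Φ j (Ψ i b) = 0)
    (hΨ : ∀ i j, i ≠ j → ∀ b c, Ψ i b * Ψ j c = 0)
    (hd : Dense (AddSubmonoid.closure (⋃ i, Set.range (Ψ i)) : Set A)) {a : A}
    (ha : ∀ i, Φ i a = 0) : a = 0 := by
  have h1 : ∀ i (b : B i) (x : A), Ψ i b * x = Ψ i (b * Φ i x) := fun i b x => by
    refine hd.induction (P := fun x => Ψ i b * x = Ψ i (b * Φ i x)) (fun x hx => ?_)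
      (isClosed_eq (continuous_const.mul continuous_id)
        ((map_continuous (Ψ i)).comp (continuous_const.mul (map_continuous (Φ i))))) x
    induction hx using AddSubmonoid.closure_induction with
    | mem x hx =>
      obtain ⟨j, c, rfl⟩ := Set.mem_iUnion.1 hx
      by_cases hij : i = j
      · subst hij
        rw [hΦΨ, map_mul]
      · rw [hΨ i j hij, hΦΨ_ne j i (Ne.symm hij), mul_zero, map_zero]
    | zero => simp
    | add x y _ _ hx hy => rw [mul_add, hx, hy, map_add, mul_add, map_add]
  have h2 : star a * a = 0 := by
    refine hd.induction (P := fun x => x * a = 0) (fun x hx => ?_)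
      (isClosed_eq (continuous_id.mul continuous_const) continuous_const) (star a)
    induction hx using AddSubmonoid.closure_induction with
    | mem x hx =>
      obtain ⟨i, b, rfl⟩ := Set.mem_iUnion.1 hx
      rw [h1, ha, mul_zero, map_zero]
    | zero => exact zero_mul a
    | add x y _ _ hx hy => rw [add_mul, hx, hy, add_zero]
  exact CStarRing.star_mul_self_eq_zero_iff a |>.1 h2

/-- A C*-algebra `A` that is generated by mutually orthogonal copies `Ψ_i(B_i)` of C*-algebras
`B_i`, with coordinate homomorphisms `Φ_i`, is the `c₀`-direct sum of the `B_i`. -/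
theorem nonempty_starAlgEquiv_c0Sum (Φ : ∀ i, A →⋆ₙₐ[ℂ] B i) (Ψ : ∀ i, B i →⋆ₙₐ[ℂ] A)
    (hΦΨ : ∀ i b, Φ i (Ψ i b) = b) (hΦΨ_ne : ∀ i j, i ≠ j → ∀ b, Φ j (Ψ i b) = 0)
    (hΨ : ∀ i j, i ≠ j → ∀ b c, Ψ i b * Ψ j c = 0)
    (hd : Dense (AddSubmonoid.closure (⋃ i, Set.range (Ψ i)) : Set A)) :
    Nonempty (A ≃⋆ₐ[ℂ] c0Sum B) := by
  let Θ : A →⋆ₙₐ[ℂ] ∀ i, B i :=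
    { toFun := fun a i => Φ i a
      map_smul' := fun c a => funext fun i => map_smul (Φ i) c a
      map_zero' := funext fun i => map_zero (Φ i)
      map_add' := fun a b => funext fun i => map_add (Φ i) a b
      map_mul' := fun a b => funext fun i => map_mul (Φ i) a b
      map_star' := fun a => funext fun i => map_star (Φ i) a }
  let Θ' : A →⋆ₙₐ[ℂ] c0Sum B := NonUnitalStarAlgHom.codRestrict Θ (c0Sum B)
    (mem_c0Sum_of_dense Φ Ψ hΦΨ_ne hd)
  refine ⟨StarAlgEquiv.ofBijective Θ' ⟨?_, ?_⟩⟩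
  · refine (injective_iff_map_eq_zero Θ').2 fun a ha => ?_
    exact eq_zero_of_forall_apply_eq_zero Φ Ψ hΦΨ hΦΨ_ne hΨ hd fun i =>
      congrFun (congrArg Subtype.val ha) i
  · intro b
    have hs := summable_orthogonal Ψ hΨ b.1 b.2
    refine ⟨∑' i, Ψ i (b.1 i), Subtype.ext (funext fun j => ?_)⟩
    change Φ j (∑' i, Ψ i (b.1 i)) = b.1 j
    rw [hs.map_tsum (Φ j) (map_continuous (Φ j)),
      tsum_eq_single j fun i hi => hΦΨ_ne i j hi _, hΦΨ]

end Recognition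

/-! ### Functoriality of crossed products -/

namespace QuasiAction

variable {G G' A A' : Type u} [Groupoid.{u} G] [Groupoid.{u} G'] [NonUnitalCStarAlgebra A]
  [NonUnitalCStarAlgebra A']

namespace Alg

variable (β : QuasiAction G A)

/-- The monomial `a t` of `A[G]`. -/
def monomial (t : Arrow G) (a : A) (ha : a ∈ β.dom (Mor.inv t)) : β.Alg :=
  ⟨Finsupp.single t a, β.single_mem ha⟩

theorem coe_monomial (t : Arrow G) (a : A) (ha : a ∈ β.dom (Mor.inv t)) :
    coe (monomial β t a ha) = Finsupp.single t a := rfl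

@[elab_as_elim]
theorem induction {q : β.Alg → Prop} (f : β.Alg) (h0 : q 0) (ha : ∀ f g, q f → q g → q (f + g))
    (hm : ∀ t a h, q (monomial β t a h)) : q f := by
  have h := β.mem_induction (q := fun f => ∃ h : f ∈ β.algebraSubmodule, q ⟨f, h⟩)
    ⟨Submodule.zero_mem _, h0⟩
    (fun f g ⟨hf, h1⟩ ⟨hg, h2⟩ => ⟨Submodule.add_mem _ hf hg, ha _ _ h1 h2⟩)
    (fun t a h => ⟨β.single_mem h, hm t a h⟩) (coe f) (coe_mem β f)
  exact h.2

end Alg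

theorem l1Norm_add_le (f g : Arrow G →₀ A) : l1Norm (f + g) ≤ l1Norm f + l1Norm g := by
  classical
  unfold l1Norm
  rw [Finsupp.sum_of_support_subset (f + g) Finsupp.support_add _ (by simp),
    Finsupp.sum_of_support_subset f (Finset.subset_union_left (s₂ := g.support)) _ (by simp),
    Finsupp.sum_of_support_subset g (Finset.subset_union_right (s₁ := f.support)) _ (by simp),
    ← Finset.sum_add_distrib]
  exact Finset.sum_le_sum fun t _ => norm_add_le (f t) (g t)

theorem l1Norm_single (t : Arrow G) (a : A) : l1Norm (Finsupp.single t a) = ‖a‖ :=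
  Finsupp.sum_single_index norm_zero

/-- The family of linear maps `a ↦ j t a` extends, by `a t ↦ j t a`, to an `ℓ¹`-contractive
*-homomorphism `A[G] → A'[G']`. -/
structure IsAlgHomData (β : QuasiAction G A) (β' : QuasiAction G' A')
    (j : Arrow G → A →ₗ[ℂ] (Arrow G' →₀ A')) : Prop where
  l1Norm_le : ∀ t a, l1Norm (j t a) ≤ ‖a‖
  mem : ∀ t a, a ∈ β.dom (Mor.inv t) → j t a ∈ β'.algebraSubmodule
  mul : ∀ t a v b, a ∈ β.dom (Mor.inv t) → b ∈ β.dom (Mor.inv v) →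
    Finsupp.lsum ℂ j (β.mulTerm t a v b) = β'.mul (j t a) (j v b)
  adjoint : ∀ t a, a ∈ β.dom (Mor.inv t) →
    j (Mor.inv t) (β.hom (Mor.inv t) (star a)) = β'.adjoint (j t a)

namespace IsAlgHomData

variable {β : QuasiAction G A} {β' : QuasiAction G' A'}
  {j : Arrow G → A →ₗ[ℂ] (Arrow G' →₀ A')}

theorem lsum_mem (hj : IsAlgHomData β β' j) {f : Arrow G →₀ A} (hf : f ∈ β.algebraSubmodule) :
    Finsupp.lsum ℂ j f ∈ β'.algebraSubmodule :=
  Submodule.sum_mem _ fun t _ => hj.mem t _ (hf t)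

theorem l1Norm_lsum_le (hj : IsAlgHomData β β' j) (f : Arrow G →₀ A) :
    l1Norm (Finsupp.lsum ℂ j f) ≤ l1Norm f := by
  refine (Finset.le_sum_of_subadditive l1Norm Finsupp.sum_zero_index.le l1Norm_add_le
    f.support fun t => j t (f t)).trans ?_
  exact Finset.sum_le_sum fun t _ => hj.l1Norm_le t (f t)

/-- The *-homomorphism `A[G] → A'[G']` with `a t ↦ j t a`. -/
def algHom (hj : IsAlgHomData β β' j) : β.Alg →⋆ₙₐ[ℂ] β'.Alg where
  toFun f := ⟨Finsupp.lsum ℂ j (Alg.coe f), hj.lsum_mem (Alg.coe_mem β f)⟩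
  map_smul' c f := Alg.coe_inj β' (map_smul (Finsupp.lsum ℂ j) c (Alg.coe f))
  map_zero' := Alg.coe_inj β' (map_zero (Finsupp.lsum ℂ j))
  map_add' f g := Alg.coe_inj β' (map_add (Finsupp.lsum ℂ j) (Alg.coe f) (Alg.coe g))
  map_mul' f g := by
    refine Alg.coe_inj β' ?_
    change Finsupp.lsum ℂ j (β.mul (Alg.coe f) (Alg.coe g)) =
      β'.mul (Finsupp.lsum ℂ j (Alg.coe f)) (Finsupp.lsum ℂ j (Alg.coe g))
    induction f using Alg.induction with
    | h0 => simp only [Alg.coe_zero, β.zero_mul, map_zero, β'.zero_mul]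
    | ha f f' h1 h2 => simp only [Alg.coe_add, β.add_mul, map_add, β'.add_mul, h1, h2]
    | hm t a ha =>
    induction g using Alg.induction with
    | h0 => simp only [Alg.coe_zero, β.mul_zero, map_zero, β'.mul_zero]
    | ha g g' h1 h2 => simp only [Alg.coe_add, β.mul_add, map_add, β'.mul_add, h1, h2]
    | hm v b hb =>
    rw [Alg.coe_monomial, Alg.coe_monomial, β.single_mul_single, hj.mul t a v b ha hb,
      Finsupp.lsum_single, Finsupp.lsum_single]
  map_star' f := by
    refine Alg.coe_inj β' ?_
    change Finsupp.lsum ℂ j (β.adjoint (Alg.coe f)) = β'.adjoint (Finsupp.lsum ℂ j (Alg.coe f))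
    induction f using Alg.induction with
    | h0 => simp only [Alg.coe_zero, β.adjoint_zero, map_zero, β'.adjoint_zero]
    | ha f f' h1 h2 => simp only [Alg.coe_add, β.adjoint_add, map_add, β'.adjoint_add, h1, h2]
    | hm t a ha =>
    rw [Alg.coe_monomial, β.adjoint_single, Finsupp.lsum_single, Finsupp.lsum_single,
      hj.adjoint t a ha]

/-- Representations of `A'[G']` pull back along an `ℓ¹`-contractive *-homomorphism, so it does not
increase the crossed product norm. -/
theorem crossedNorm_algHom_le (hj : IsAlgHomData β β' j) (f : β.Alg) :
    β'.crossedNorm (hj.algHom f) ≤ β.crossedNorm f := by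
  have : Nonempty β'.repSeminorms := β'.repSeminorms_nonempty.to_subtype
  refine ciSup_le ?_
  rintro ⟨_, E, _, _, _, σ, hσ, rfl⟩
  refine le_ciSup (f := fun p : β.repSeminorms => p.1 f) ⟨l1Norm (Alg.coe f), ?_⟩
    ⟨_, E, _, _, _, σ.comp hj.algHom,
      fun f => (hσ _).trans (hj.l1Norm_lsum_le (Alg.coe f)), rfl⟩
  rintro _ ⟨⟨_, E, _, _, _, τ, hτ, rfl⟩, rfl⟩
  exact hτ f

end IsAlgHomData

namespace CrossedProduct

variable (β : QuasiAction G A)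

/-- The canonical *-homomorphism of `A[G]` into the crossed product. -/
def ofAlg : β.Alg →⋆ₙₐ[ℂ] β.CrossedProduct where
  toFun := CStarCompletion.of β.isCStarSeminorm_crossedNorm
  map_smul' c x := CStarCompletion.of_smul _ c x
  map_zero' := CStarCompletion.of_zero _
  map_add' x y := CStarCompletion.of_add _ x y
  map_mul' x y := CStarCompletion.of_mul _ x y
  map_star' x := CStarCompletion.of_star _ x

/-- The monomial `a t` in the crossed product. -/
def monomial (t : Arrow G) (a : A) (ha : a ∈ β.dom (Mor.inv t)) : β.CrossedProduct :=
  ofAlg β (Alg.monomial β t a ha)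

theorem monomial_congr {t t' : Arrow G} {a a' : A} (ht : t = t') (h : a = a')
    (ha : a ∈ β.dom (Mor.inv t)) (ha' : a' ∈ β.dom (Mor.inv t')) :
    monomial β t a ha = monomial β t' a' ha' := by
  subst ht; subst h; rfl

theorem monomial_mul_of_not (t : Arrow G) (a : A) (ha : a ∈ β.dom (Mor.inv t)) (v : Arrow G)
    (b : A) (hb : b ∈ β.dom (Mor.inv v)) (h : ¬Mor.Composable t v) :
    monomial β t a ha * monomial β v b hb = 0 := by
  rw [monomial, monomial, ← map_mul, ← map_zero (ofAlg β)]
  refine congrArg (ofAlg β) (Alg.coe_inj β ?_)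
  rw [Alg.coe_mul, Alg.coe_monomial, Alg.coe_monomial, β.single_mul_single,
    β.mulTerm_of_not _ _ _ _ h, Alg.coe_zero]

@[elab_as_elim]
theorem induction {q : β.CrossedProduct → Prop} (x : β.CrossedProduct) (hc : IsClosed {x | q x})
    (h0 : q 0) (ha : ∀ x y, q x → q y → q (x + y)) (hm : ∀ t a h, q (monomial β t a h)) :
    q x := by
  refine CStarCompletion.induction_on _ x hc fun f => ?_
  change q (ofAlg β f)
  induction f using Alg.induction with
  | h0 => rwa [map_zero]
  | ha f g h1 h2 => rw [map_add]; exact ha _ _ h1 h2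
  | hm t a h => exact hm t a h

variable {β} {β' : QuasiAction G' A'} {j : Arrow G → A →ₗ[ℂ] (Arrow G' →₀ A')}

/-- The *-homomorphism of crossed products with `a t ↦ j t a`. -/
def map (hj : IsAlgHomData β β' j) : β.CrossedProduct →⋆ₙₐ[ℂ] β'.CrossedProduct :=
  CStarCompletion.lift _ ((ofAlg β').comp hj.algHom) fun f =>
    (CStarCompletion.norm_of _ (hj.algHom f)).trans_le (hj.crossedNorm_algHom_le f)

theorem map_monomial_of_eq_single (hj : IsAlgHomData β β' j) (t : Arrow G) (a : A)
    (ha : a ∈ β.dom (Mor.inv t)) {t' : Arrow G'} {a' : A'} (ha' : a' ∈ β'.dom (Mor.inv t'))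
    (h : j t a = Finsupp.single t' a') :
    map hj (monomial β t a ha) = monomial β' t' a' ha' := by
  refine (CStarCompletion.lift_of _ _ _ _).trans ?_
  refine congrArg (ofAlg β') (Alg.coe_inj β' ?_)
  exact (Finsupp.lsum_single ..).trans h

theorem map_monomial_of_eq_zero (hj : IsAlgHomData β β' j) (t : Arrow G) (a : A)
    (ha : a ∈ β.dom (Mor.inv t)) (h : j t a = 0) : map hj (monomial β t a ha) = 0 := by
  refine (CStarCompletion.lift_of _ _ _ _).trans ?_
  refine (congrArg (ofAlg β') (Alg.coe_inj β' ?_)).trans (map_zero (ofAlg β'))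
  exact (Finsupp.lsum_single ..).trans h

end CrossedProduct

end QuasiAction

/-! ### Crossed products by full subgroupoids -/

namespace Mor

variable {C : Type u} [Category.{u} C] {P : ObjectProperty C}

theorem composable_toSub {f g : Arrow C} (h : Composable f g) (hfl : P f.left) (hfr : P f.right)
    (hgl : P g.left) (hgr : P g.right) : Composable (toSub f hfl hfr) (toSub g hgl hgr) :=
  composable_of_ofSub h

theorem toSub_comp (f g : Arrow C) (h : Composable f g) (hfl : P f.left) (hfr : P f.right)
    (hgl : P g.left) (hgr : P g.right) :
    toSub (comp f g h) hgl hfr =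
      comp (toSub f hfl hfr) (toSub g hgl hgr) (composable_toSub h hfl hfr hgl hgr) :=
  ofSub_injective (ofSub_comp (toSub f hfl hfr) (toSub g hgl hgr)
    (composable_toSub h hfl hfr hgl hgr)).symm

end Mor

namespace QuasiAction

variable {G A A' : Type u} [Groupoid.{u} G] [NonUnitalCStarAlgebra A] [NonUnitalCStarAlgebra A']
  {P : ObjectProperty G}

/-- The family of maps `a ↦ e(a) t`, for `t` in a full subgroupoid. -/
def inclData (P : ObjectProperty G) (e : A' →⋆ₙₐ[ℂ] A) (t : Arrow P.FullSubcategory) :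
    A' →ₗ[ℂ] (Arrow G →₀ A) :=
  (Finsupp.lsingle (Mor.ofSub t)).comp (e : A' →ₗ[ℂ] A)

theorem inclData_apply (e : A' →⋆ₙₐ[ℂ] A) (t : Arrow P.FullSubcategory) (a : A') :
    inclData P e t a = Finsupp.single (Mor.ofSub t) (e a) := rfl

open Classical in
/-- The family of maps `a ↦ r(a) t` for `t` in a full subgroupoid, and `a ↦ 0` for the other
elements `t` of the groupoid. -/
def restrictData (P : ObjectProperty G) (r : A →⋆ₙₐ[ℂ] A') (t : Arrow G) :
    A →ₗ[ℂ] (Arrow P.FullSubcategory →₀ A') :=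
  if h : P t.left ∧ P t.right then
    (Finsupp.lsingle (Mor.toSub t h.1 h.2)).comp (r : A →ₗ[ℂ] A')
  else 0

theorem restrictData_of_mem (r : A →⋆ₙₐ[ℂ] A') {t : Arrow G} (hl : P t.left) (hr : P t.right)
    (a : A) : restrictData P r t a = Finsupp.single (Mor.toSub t hl hr) (r a) := by
  rw [restrictData, dif_pos ⟨hl, hr⟩]; rfl

theorem restrictData_of_not (r : A →⋆ₙₐ[ℂ] A') {t : Arrow G} (h : ¬(P t.left ∧ P t.right))
    (a : A) : restrictData P r t a = 0 := by
  rw [restrictData, dif_neg h]; rfl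

variable {β : QuasiAction G A} {β' : QuasiAction P.FullSubcategory A'}

theorem isAlgHomData_inclData (e : A' →⋆ₙₐ[ℂ] A)
    (hdom : ∀ t, ∀ a ∈ β'.dom t, e a ∈ β.dom (Mor.ofSub t))
    (hhom : ∀ t a, e (β'.hom t a) = β.hom (Mor.ofSub t) (e a)) :
    IsAlgHomData β' β (inclData P e) where
  l1Norm_le t a := by
    rw [inclData_apply, l1Norm_single]
    exact NonUnitalStarAlgHom.norm_apply_le e a
  mem t a ha := β.single_mem (hdom _ a ha)
  mul t a v b _ _ := by
    rw [inclData_apply, inclData_apply, single_mul_single]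
    by_cases h : Mor.Composable t v
    · rw [β'.mulTerm_of_composable _ _ _ _ h, Finsupp.lsum_single, inclData_apply,
        β.mulTerm_of_composable _ _ _ _ (Mor.composable_ofSub h), Mor.ofSub_comp, map_mul, hhom]
    · rw [β'.mulTerm_of_not _ _ _ _ h, map_zero,
        β.mulTerm_of_not _ _ _ _ fun h' => h (Mor.composable_of_ofSub h')]
  adjoint t a _ := by
    rw [inclData_apply, inclData_apply, adjoint_single, hhom, map_star]
    rfl

/-- If no element of `G` leaves the set `P` of units, the elements with units outside of `P` can be
sent to zero. -/
theorem isAlgHomData_restrictData (hP : ∀ t : Arrow G, P t.left ↔ P t.right) (r : A →⋆ₙₐ[ℂ] A')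
    (hdom : ∀ t hl hr, ∀ a ∈ β.dom t, r a ∈ β'.dom (Mor.toSub t hl hr))
    (hhom : ∀ t hl hr a, r (β.hom t a) = β'.hom (Mor.toSub t hl hr) (r a)) :
    IsAlgHomData β β' (restrictData P r) where
  l1Norm_le t a := by
    by_cases h : P t.left ∧ P t.right
    · rw [restrictData_of_mem r h.1 h.2, l1Norm_single]
      exact NonUnitalStarAlgHom.norm_apply_le r a
    · rw [restrictData_of_not r h]
      exact Finsupp.sum_zero_index.trans_le (norm_nonneg a)
  mem t a ha := by
    by_cases h : P t.left ∧ P t.right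
    · rw [restrictData_of_mem r h.1 h.2]
      exact β'.single_mem (hdom _ h.2 h.1 a ha)
    · rw [restrictData_of_not r h]
      exact Submodule.zero_mem _
  mul t a v b _ _ := by
    by_cases h : Mor.Composable t v
    · rw [β.mulTerm_of_composable _ _ _ _ h, Finsupp.lsum_single]
      by_cases ht : P t.left
      · have htr := (hP t).1 ht
        have hvr : P v.right := (congrArg P h).mp ht
        have hv := (hP v).2 hvr
        rw [restrictData_of_mem r (t := Mor.comp t v h) hv htr, restrictData_of_mem r ht htr,
          restrictData_of_mem r hv hvr, β'.single_mul_single, β'.mulTerm_of_composable _ _ _ _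
            (Mor.composable_toSub h ht htr hv hvr), Mor.toSub_comp t v h ht htr hv hvr, map_mul,
          hhom t ht htr]
      · rw [restrictData_of_not r (t := t) fun h' => ht h'.1, β'.zero_mul,
          restrictData_of_not r (t := Mor.comp t v h) fun h' => ht ((hP t).2 h'.2)]
    · rw [β.mulTerm_of_not _ _ _ _ h, map_zero]
      by_cases ht : P t.left ∧ P t.right
      · by_cases hv : P v.left ∧ P v.right
        · rw [restrictData_of_mem r ht.1 ht.2, restrictData_of_mem r hv.1 hv.2,
            β'.single_mul_single, β'.mulTerm_of_not (Mor.toSub t ht.1 ht.2) _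
              (Mor.toSub v hv.1 hv.2) _ fun h' => h (Mor.composable_ofSub h')]
        · rw [restrictData_of_not r hv, β'.mul_zero]
      · rw [restrictData_of_not r ht, β'.zero_mul]
  adjoint t a _ := by
    by_cases h : P t.left ∧ P t.right
    · rw [restrictData_of_mem r h.1 h.2, restrictData_of_mem r (t := Mor.inv t) h.2 h.1,
        adjoint_single, hhom _ h.2 h.1, map_star]
      rfl
    · rw [restrictData_of_not r h, β'.adjoint_zero,
        restrictData_of_not r (t := Mor.inv t) fun h' => h ⟨h'.2, h'.1⟩]

end QuasiAction

/-! ### Restricting an action to an invariant set of units -/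

namespace GroupoidAction

variable {G H : Type u} [Groupoid.{u} G] [Category.{u} H] {α : GroupoidAction G H}

theorem IsRegular.lyingOver_iff (hα : α.IsRegular) (P : ObjectProperty G) (h : Arrow H) :
    α.lyingOver P h.left ↔ α.lyingOver P h.right := iff_of_eq (congrArg P (hα h))

/-- A common multiple in `H` of two morphisms over `P` is also one over `P`. -/
theorem IsRegular.intersect_of_ofSub (hα : α.IsRegular) {P : ObjectProperty G}
    {f g : Arrow (α.lyingOver P).FullSubcategory}
    (hi : Mor.Intersect (Mor.ofSub f) (Mor.ofSub g)) : Mor.Intersect f g := by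
  obtain ⟨k, l, hk, hl, he⟩ := hi
  have hkr : α.lyingOver P k.right := (congrArg (α.lyingOver P) hk).mp f.left.property
  have hlr : α.lyingOver P l.right := (congrArg (α.lyingOver P) hl).mp g.left.property
  have hk' : Mor.Composable f (Mor.toSub k ((hα.lyingOver_iff P k).2 hkr) hkr) :=
    Mor.composable_of_ofSub hk
  have hl' : Mor.Composable g (Mor.toSub l ((hα.lyingOver_iff P l).2 hlr) hlr) :=
    Mor.composable_of_ofSub hl
  refine ⟨_, _, hk', hl', Mor.ofSub_injective ?_⟩
  rw [Mor.ofSub_comp, Mor.ofSub_comp]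
  exact he

theorem isCatRepresentation_incl (hα : α.IsRegular) (P : ObjectProperty G) :
    IsCatRepresentation fun f : Arrow (α.lyingOver P).FullSubcategory =>
      CatCStar.S (Mor.ofSub f) := by
  have hS := CatCStar.isCatRepresentation_S (Λ := H)
  constructor
  · exact fun f => hS.partialIsometry _
  · intro f g h
    rw [Mor.ofSub_comp]
    exact hS.mul_of_composable _ _ _
  · exact fun f g h => hS.mul_of_not_composable _ _ fun h' => h (Mor.composable_of_ofSub h')
  · exact fun f g => hS.commute_initial _ _
  · exact fun f g => hS.commute_final _ _
  · exact fun f g => hS.commute_initial_final _ _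
  · exact fun f g h => hS.final_mul_final _ _ fun h' => h (hα.intersect_of_ofSub h')
  · exact fun f g h => hS.initial_mul_final _ _ (Mor.composable_ofSub h)

/-- The *-homomorphism `C*(H_P) → C*(H)` with `S h ↦ S h`, where `H_P` is the part of `H` over
`P`. -/
def inclHom (hα : α.IsRegular) (P : ObjectProperty G) :
    CatCStar (α.lyingOver P).FullSubcategory →⋆ₙₐ[ℂ] CatCStar H :=
  CatCStar.lift _ (isCatRepresentation_incl hα P)

theorem inclHom_S (hα : α.IsRegular) (P : ObjectProperty G)
    (f : Arrow (α.lyingOver P).FullSubcategory) :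
    inclHom hα P (CatCStar.S f) = CatCStar.S (Mor.ofSub f) := CatCStar.lift_S _ _ _

open Classical in
variable (α) in
/-- The map `h ↦ S h` for `h` in the part of `H` over `P`, and `h ↦ 0` otherwise. -/
def restrictRep (P : ObjectProperty G) (h : Arrow H) :
    CatCStar (α.lyingOver P).FullSubcategory :=
  if hP : α.lyingOver P h.left ∧ α.lyingOver P h.right then
    CatCStar.S (Mor.toSub h hP.1 hP.2) else 0

theorem restrictRep_of_mem {P : ObjectProperty G} {h : Arrow H} (hl : α.lyingOver P h.left)
    (hr : α.lyingOver P h.right) : α.restrictRep P h = CatCStar.S (Mor.toSub h hl hr) :=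
  dif_pos ⟨hl, hr⟩

theorem restrictRep_of_not {P : ObjectProperty G} {h : Arrow H}
    (hP : ¬(α.lyingOver P h.left ∧ α.lyingOver P h.right)) : α.restrictRep P h = 0 :=
  dif_neg hP

theorem restrictRep_eq (P : ObjectProperty G) (h : Arrow H) :
    (∃ hl hr, α.restrictRep P h = CatCStar.S (Mor.toSub h hl hr)) ∨ α.restrictRep P h = 0 := by
  by_cases hP : α.lyingOver P h.left ∧ α.lyingOver P h.right
  · exact Or.inl ⟨hP.1, hP.2, restrictRep_of_mem _ _⟩
  · exact Or.inr (restrictRep_of_not hP)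

theorem isCatRepresentation_restrictRep (hα : α.IsRegular) (P : ObjectProperty G) :
    IsCatRepresentation (α.restrictRep P) := by
  have hS := CatCStar.isCatRepresentation_S (Λ := (α.lyingOver P).FullSubcategory)
  constructor
  · intro f
    obtain ⟨_, _, hf⟩ | hf := α.restrictRep_eq P f
    · rw [hf, hS.partialIsometry]
    · simp [hf]
  · intro f g h
    by_cases hf : α.lyingOver P f.left
    · have hfr := (hα.lyingOver_iff P f).1 hf
      have hgr : α.lyingOver P g.right := (congrArg (α.lyingOver P) h).mp hf
      have hg := (hα.lyingOver_iff P g).2 hgr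
      rw [restrictRep_of_mem hf hfr, restrictRep_of_mem hg hgr,
        restrictRep_of_mem (h := Mor.comp f g h) hg hfr, Mor.toSub_comp f g h hf hfr hg hgr,
        hS.mul_of_composable _ _ (Mor.composable_toSub h hf hfr hg hgr)]
    · rw [restrictRep_of_not (h := f) fun h' => hf h'.1, zero_mul,
        restrictRep_of_not (h := Mor.comp f g h) fun h' =>
          hf ((hα.lyingOver_iff P f).2 h'.2)]
  · intro f g h
    obtain ⟨_, _, hf⟩ | hf := α.restrictRep_eq P f
    · obtain ⟨_, _, hg⟩ | hg := α.restrictRep_eq P g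
      · rw [hf, hg]
        exact hS.mul_of_not_composable _ _ fun h' => h (Mor.composable_ofSub h')
      · simp [hg]
    · simp [hf]
  · intro f g
    obtain ⟨_, _, hf⟩ | hf := α.restrictRep_eq P f
    · obtain ⟨_, _, hg⟩ | hg := α.restrictRep_eq P g
      · rw [hf, hg]
        exact hS.commute_initial _ _
      · simp [hg]
    · simp [hf]
  · intro f g
    obtain ⟨_, _, hf⟩ | hf := α.restrictRep_eq P f
    · obtain ⟨_, _, hg⟩ | hg := α.restrictRep_eq P g
      · rw [hf, hg]
        exact hS.commute_final _ _
      · simp [hg]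
    · simp [hf]
  · intro f g
    obtain ⟨_, _, hf⟩ | hf := α.restrictRep_eq P f
    · obtain ⟨_, _, hg⟩ | hg := α.restrictRep_eq P g
      · rw [hf, hg]
        exact hS.commute_initial_final _ _
      · simp [hg]
    · simp [hf]
  · intro f g hi
    obtain ⟨_, _, hf⟩ | hf := α.restrictRep_eq P f
    · obtain ⟨_, _, hg⟩ | hg := α.restrictRep_eq P g
      · rw [hf, hg]
        refine hS.final_mul_final _ _ fun ⟨k, l, hk, hl, he⟩ => hi ?_
        refine ⟨Mor.ofSub k, Mor.ofSub l, Mor.composable_ofSub hk, Mor.composable_ofSub hl, ?_⟩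
        have he' := congrArg Mor.ofSub he
        rwa [Mor.ofSub_comp, Mor.ofSub_comp] at he'
      · simp [hg]
    · simp [hf]
  · intro f g h
    obtain ⟨_, _, hg⟩ | hg := α.restrictRep_eq P g
    · have hf : α.lyingOver P f.left := (congrArg (α.lyingOver P) h).mpr ‹_›
      rw [hg, restrictRep_of_mem hf ((hα.lyingOver_iff P f).1 hf)]
      exact hS.initial_mul_final _ _ (ObjectProperty.FullSubcategory.ext h)
    · simp [hg]

/-- The *-homomorphism `C*(H) → C*(H_P)` with `S h ↦ S h` if `h` is in the part `H_P` of `H` over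
`P`, and `S h ↦ 0` otherwise. -/
def restrictHom (hα : α.IsRegular) (P : ObjectProperty G) :
    CatCStar H →⋆ₙₐ[ℂ] CatCStar (α.lyingOver P).FullSubcategory :=
  CatCStar.lift _ (isCatRepresentation_restrictRep hα P)

theorem restrictHom_S (hα : α.IsRegular) (P : ObjectProperty G) (h : Arrow H) :
    restrictHom hα P (CatCStar.S h) = α.restrictRep P h := CatCStar.lift_S _ _ _

theorem restrictHom_inclHom (hα : α.IsRegular) (P : ObjectProperty G)
    (a : CatCStar (α.lyingOver P).FullSubcategory) :
    restrictHom hα P (inclHom hα P a) = a := by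
  have h : (restrictHom hα P).comp (inclHom hα P) = NonUnitalStarAlgHom.id ℂ _ := by
    refine CatCStar.hom_ext fun f => ?_
    change restrictHom hα P (inclHom hα P (CatCStar.S f)) = CatCStar.S f
    rw [inclHom_S, restrictHom_S, restrictRep_of_mem f.left.property f.right.property,
      Mor.toSub_ofSub]
  exact DFunLike.congr_fun h a

theorem inclHom_restrictHom (hα : α.IsRegular) {P : ObjectProperty G} {t : Arrow G}
    (ht : P t.left) {a : CatCStar H} (ha : a ∈ α.tildeDom t) :
    inclHom hα P (restrictHom hα P a) = a := by
  refine eq_on_tildeDom (φ := (inclHom hα P).comp (restrictHom hα P))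
    (ψ := NonUnitalStarAlgHom.id ℂ _) (fun k hk => ?_) ha
  change inclHom hα P (restrictHom hα P (CatCStar.S k)) = CatCStar.S k
  rw [restrictHom_S, restrictRep_of_mem ((congrArg P hk.2).mp ht) ((congrArg P hk.1).mp ht),
    inclHom_S]
  rfl

theorem apply_mem_of_mem_tildeDom {B : Type u} [NonUnitalCStarAlgebra B] {g : Arrow G}
    (φ : CatCStar H →⋆ₙₐ[ℂ] B) (K : NonUnitalStarSubalgebra ℂ B) (hK : IsClosed (K : Set B))
    (h : ∀ k, α.Dom g k → φ (CatCStar.S k) ∈ K) {a : CatCStar H} (ha : a ∈ α.tildeDom g) :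
    φ a ∈ K := by
  have h1 : α.tildeDom g ≤ K.comap φ := by
    refine NonUnitalStarSubalgebra.topologicalClosure_minimal _
      (NonUnitalStarAlgebra.adjoin_le ?_) (hK.preimage (map_continuous φ))
    rintro _ ⟨k, hk, rfl⟩
    exact h k hk
  exact h1 ha

theorem dom_ofSub_iff {P : ObjectProperty G} {t : Arrow P.FullSubcategory}
    {h : Arrow (α.lyingOver P).FullSubcategory} :
    α.Dom (Mor.ofSub t) (Mor.ofSub h) ↔ (α.restrict P).Dom t h :=
  ⟨fun hd => ⟨ObjectProperty.FullSubcategory.ext hd.1, ObjectProperty.FullSubcategory.ext hd.2⟩,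
    fun hd => ⟨congrArg ObjectProperty.FullSubcategory.obj hd.1,
      congrArg ObjectProperty.FullSubcategory.obj hd.2⟩⟩

theorem inclHom_tildeHom (hα : α.IsRegular) (P : ObjectProperty G) (t : Arrow P.FullSubcategory)
    (a : CatCStar (α.lyingOver P).FullSubcategory) :
    inclHom hα P (tildeHom (hα.restrict P) t a) = tildeHom hα (Mor.ofSub t) (inclHom hα P a) := by
  have h : (inclHom hα P).comp (tildeHom (hα.restrict P) t) =
      (tildeHom hα (Mor.ofSub t)).comp (inclHom hα P) := by
    refine CatCStar.hom_ext fun f => ?_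
    change inclHom hα P (tildeHom (hα.restrict P) t (CatCStar.S f)) =
      tildeHom hα (Mor.ofSub t) (inclHom hα P (CatCStar.S f))
    rw [inclHom_S, tildeHom_S, tildeHom_S]
    by_cases hd : (α.restrict P).Dom t f
    · rw [tildeRep_of_dom hd, inclHom_S, tildeRep_of_dom (dom_ofSub_iff.2 hd)]
      rfl
    · rw [tildeRep_of_not hd, map_zero, tildeRep_of_not fun h => hd (dom_ofSub_iff.1 h)]
  exact DFunLike.congr_fun h a

theorem restrictHom_tildeHom (hα : α.IsRegular) (P : ObjectProperty G) (t : Arrow G)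
    (hl : P t.left) (hr : P t.right) (a : CatCStar H) :
    restrictHom hα P (tildeHom hα t a) =
      tildeHom (hα.restrict P) (Mor.toSub t hl hr) (restrictHom hα P a) := by
  have h : (restrictHom hα P).comp (tildeHom hα t) =
      (tildeHom (hα.restrict P) (Mor.toSub t hl hr)).comp (restrictHom hα P) := by
    refine CatCStar.hom_ext fun f => ?_
    change restrictHom hα P (tildeHom hα t (CatCStar.S f)) =
      tildeHom (hα.restrict P) (Mor.toSub t hl hr) (restrictHom hα P (CatCStar.S f))
    rw [restrictHom_S, tildeHom_S]
    by_cases hf : α.lyingOver P f.left ∧ α.lyingOver P f.right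
    · rw [restrictRep_of_mem hf.1 hf.2, tildeHom_S]
      by_cases hd : α.Dom t f
      · rw [tildeRep_of_dom hd, restrictHom_S,
          restrictRep_of_mem ((congrArg P (α.φ_act_left t f hd)).mpr hr)
            ((congrArg P (α.φ_act_right t f hd)).mpr hr),
          tildeRep_of_dom (α := α.restrict P) (g := Mor.toSub t hl hr)
            (h := Mor.toSub f hf.1 hf.2) (dom_ofSub_iff.1 hd)]
        rfl
      · rw [tildeRep_of_not hd, map_zero, tildeRep_of_not fun h => hd (dom_ofSub_iff.2 h)]
    · rw [restrictRep_of_not hf, map_zero, tildeRep_of_not, map_zero]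
      exact fun hd => hf ⟨(congrArg P hd.2).mp hl, (congrArg P hd.1).mp hl⟩
  exact DFunLike.congr_fun h a

theorem inclHom_mem_tildeDom (hα : α.IsRegular) {P : ObjectProperty G}
    {t : Arrow P.FullSubcategory} {a : CatCStar (α.lyingOver P).FullSubcategory}
    (ha : a ∈ (α.restrict P).tildeDom t) : inclHom hα P a ∈ α.tildeDom (Mor.ofSub t) :=
  apply_mem_of_mem_tildeDom _ _ (isClosed_tildeDom (Mor.ofSub t)) (fun k hk => by
    rw [inclHom_S]
    exact S_mem_tildeDom (dom_ofSub_iff.2 hk)) ha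

theorem restrictHom_mem_tildeDom (hα : α.IsRegular) {P : ObjectProperty G} {t : Arrow G}
    (hl : P t.left) (hr : P t.right) {a : CatCStar H} (ha : a ∈ α.tildeDom t) :
    restrictHom hα P a ∈ (α.restrict P).tildeDom (Mor.toSub t hl hr) :=
  apply_mem_of_mem_tildeDom _ _ (isClosed_tildeDom (Mor.toSub t hl hr)) (fun k hk => by
    rw [restrictHom_S, restrictRep_of_mem ((congrArg P hk.2).mp hl) ((congrArg P hk.1).mp hl)]
    exact S_mem_tildeDom (α := α.restrict P) (g := Mor.toSub t hl hr) (dom_ofSub_iff.1 hk)) ha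

theorem isAlgHomData_inclHom (hα : α.IsRegular) (P : ObjectProperty G) :
    QuasiAction.IsAlgHomData ((α.restrict P).quasiAction (hα.restrict P)) (α.quasiAction hα)
      (QuasiAction.inclData P (inclHom hα P)) :=
  QuasiAction.isAlgHomData_inclData _
    (fun _ _ ha => inclHom_mem_tildeDom hα ha)
    (inclHom_tildeHom hα P)

theorem isAlgHomData_restrictHom (hα : α.IsRegular) (P : ObjectProperty G)
    (hP : ∀ t : Arrow G, P t.left ↔ P t.right) :
    QuasiAction.IsAlgHomData (α.quasiAction hα) ((α.restrict P).quasiAction (hα.restrict P))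
      (QuasiAction.restrictData P (restrictHom hα P)) :=
  QuasiAction.isAlgHomData_restrictData hP _
    (fun _ hl hr _ ha => restrictHom_mem_tildeDom hα hl hr ha)
    (restrictHom_tildeHom hα P)

/-- The canonical *-homomorphism `C*(H_P) × G_P → C*(H) × G`. -/
def inclCrossed (hα : α.IsRegular) (P : ObjectProperty G) :
    ((α.restrict P).quasiAction (hα.restrict P)).CrossedProduct →⋆ₙₐ[ℂ]
      (α.quasiAction hα).CrossedProduct :=
  QuasiAction.CrossedProduct.map (isAlgHomData_inclHom hα P)

/-- The canonical *-homomorphism `C*(H) × G → C*(H_P) × G_P`, for an invariant set `P` of units. -/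
def restrictCrossed (hα : α.IsRegular) (P : ObjectProperty G)
    (hP : ∀ t : Arrow G, P t.left ↔ P t.right) :
    (α.quasiAction hα).CrossedProduct →⋆ₙₐ[ℂ]
      ((α.restrict P).quasiAction (hα.restrict P)).CrossedProduct :=
  QuasiAction.CrossedProduct.map (isAlgHomData_restrictHom hα P hP)

theorem inclCrossed_monomial (hα : α.IsRegular) (P : ObjectProperty G)
    (t : Arrow P.FullSubcategory) (a : CatCStar (α.lyingOver P).FullSubcategory)
    (ha : a ∈ ((α.restrict P).quasiAction (hα.restrict P)).dom (Mor.inv t)) :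
    ∃ ha', inclCrossed hα P (QuasiAction.CrossedProduct.monomial _ t a ha) =
      QuasiAction.CrossedProduct.monomial (α.quasiAction hα) (Mor.ofSub t) (inclHom hα P a) ha' :=
  ⟨inclHom_mem_tildeDom hα (t := Mor.inv t) ha,
    QuasiAction.CrossedProduct.map_monomial_of_eq_single _ _ _ _ _
      (QuasiAction.inclData_apply _ _ _)⟩

theorem restrictCrossed_monomial (hα : α.IsRegular) (P : ObjectProperty G)
    (hP : ∀ t : Arrow G, P t.left ↔ P t.right) (t : Arrow G) (hl : P t.left) (hr : P t.right)
    (a : CatCStar H) (ha : a ∈ (α.quasiAction hα).dom (Mor.inv t))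
    (ha' : restrictHom hα P a ∈
      ((α.restrict P).quasiAction (hα.restrict P)).dom (Mor.inv (Mor.toSub t hl hr))) :
    restrictCrossed hα P hP (QuasiAction.CrossedProduct.monomial _ t a ha) =
      QuasiAction.CrossedProduct.monomial _ (Mor.toSub t hl hr) (restrictHom hα P a) ha' :=
  QuasiAction.CrossedProduct.map_monomial_of_eq_single _ _ _ _ _
    (QuasiAction.restrictData_of_mem _ _ _ _)

theorem restrictCrossed_monomial_of_not (hα : α.IsRegular) (P : ObjectProperty G)
    (hP : ∀ t : Arrow G, P t.left ↔ P t.right) (t : Arrow G) (ht : ¬P t.left)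
    (a : CatCStar H) (ha : a ∈ (α.quasiAction hα).dom (Mor.inv t)) :
    restrictCrossed hα P hP (QuasiAction.CrossedProduct.monomial _ t a ha) = 0 :=
  QuasiAction.CrossedProduct.map_monomial_of_eq_zero _ _ _ _
    (QuasiAction.restrictData_of_not _ (fun h => ht h.1) _)

end GroupoidAction

/-! ### The decomposition along a partition of the units -/

namespace GroupoidAction

variable {G H : Type u} [Groupoid.{u} G] [Category.{u} H] {α : GroupoidAction G H}

theorem restrictCrossed_inclCrossed (hα : α.IsRegular) (P : ObjectProperty G)
    (hP : ∀ t : Arrow G, P t.left ↔ P t.right)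
    (b : ((α.restrict P).quasiAction (hα.restrict P)).CrossedProduct) :
    restrictCrossed hα P hP (inclCrossed hα P b) = b := by
  induction b using QuasiAction.CrossedProduct.induction with
  | hc =>
    exact isClosed_eq ((map_continuous (restrictCrossed hα P hP)).comp
      (map_continuous (inclCrossed hα P))) continuous_id
  | h0 => simp only [map_zero]
  | ha x y hx hy => simp only [map_add, hx, hy]
  | hm t a h =>
    obtain ⟨h1, h2⟩ := inclCrossed_monomial hα P t a h
    rw [h2, restrictCrossed_monomial hα P hP (Mor.ofSub t) t.left.property t.right.property _ h1
      (by rwa [restrictHom_inclHom])]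
    exact QuasiAction.CrossedProduct.monomial_congr _ rfl (restrictHom_inclHom hα P a) _ _

theorem restrictCrossed_inclCrossed_of_disjoint (hα : α.IsRegular) (P Q : ObjectProperty G)
    (hQ : ∀ t : Arrow G, Q t.left ↔ Q t.right) (hPQ : ∀ x, P x → ¬Q x)
    (b : ((α.restrict P).quasiAction (hα.restrict P)).CrossedProduct) :
    restrictCrossed hα Q hQ (inclCrossed hα P b) = 0 := by
  induction b using QuasiAction.CrossedProduct.induction with
  | hc =>
    exact isClosed_eq ((map_continuous (restrictCrossed hα Q hQ)).comp
      (map_continuous (inclCrossed hα P))) continuous_const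
  | h0 => simp only [map_zero]
  | ha x y hx hy => simp only [map_add, hx, hy, add_zero]
  | hm t a h =>
    obtain ⟨h1, h2⟩ := inclCrossed_monomial hα P t a h
    rw [h2, restrictCrossed_monomial_of_not]
    exact hPQ _ t.left.property

theorem inclCrossed_mul_inclCrossed_of_disjoint (hα : α.IsRegular) (P Q : ObjectProperty G)
    (hPQ : ∀ x, P x → ¬Q x)
    (b : ((α.restrict P).quasiAction (hα.restrict P)).CrossedProduct)
    (c : ((α.restrict Q).quasiAction (hα.restrict Q)).CrossedProduct) :
    inclCrossed hα P b * inclCrossed hα Q c = 0 := by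
  induction b using QuasiAction.CrossedProduct.induction with
  | hc =>
    exact isClosed_eq ((map_continuous (inclCrossed hα P)).mul continuous_const) continuous_const
  | h0 => rw [map_zero, zero_mul]
  | ha x y hx hy => rw [map_add, add_mul, hx, hy, add_zero]
  | hm t a h =>
  induction c using QuasiAction.CrossedProduct.induction with
  | hc =>
    exact isClosed_eq (continuous_const.mul (map_continuous (inclCrossed hα Q))) continuous_const
  | h0 => rw [map_zero, mul_zero]
  | ha x y hx hy => rw [map_add, mul_add, hx, hy, add_zero]
  | hm v b h' =>
    obtain ⟨h1, h2⟩ := inclCrossed_monomial hα P t a h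
    obtain ⟨h3, h4⟩ := inclCrossed_monomial hα Q v b h'
    rw [h2, h4]
    refine QuasiAction.CrossedProduct.monomial_mul_of_not _ _ _ _ _ _ _ fun hc => ?_
    exact hPQ _ t.left.property ((congrArg Q hc).mpr v.right.property)

theorem monomial_mem_range_inclCrossed (hα : α.IsRegular) (P : ObjectProperty G)
    (hP : ∀ t : Arrow G, P t.left ↔ P t.right) (t : Arrow G) (ht : P t.left) (a : CatCStar H)
    (ha : a ∈ (α.quasiAction hα).dom (Mor.inv t)) :
    QuasiAction.CrossedProduct.monomial (α.quasiAction hα) t a ha ∈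
      Set.range (inclCrossed hα P) := by
  have hr := (hP t).1 ht
  have h1 : restrictHom hα P a ∈
      ((α.restrict P).quasiAction (hα.restrict P)).dom (Mor.inv (Mor.toSub t ht hr)) :=
    restrictHom_mem_tildeDom hα (t := Mor.inv t) hr ht ha
  obtain ⟨h2, h3⟩ := inclCrossed_monomial hα P (Mor.toSub t ht hr) (restrictHom hα P a) h1
  refine ⟨_, h3.trans ?_⟩
  exact QuasiAction.CrossedProduct.monomial_congr _ rfl
    (inclHom_restrictHom hα (t := Mor.inv t) hr ha) _ _

theorem dense_closure_range_inclCrossed (hα : α.IsRegular) {I : Type u}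
    (P : I → ObjectProperty G) (hP : ∀ i (t : Arrow G), P i t.left ↔ P i t.right)
    (hcover : ∀ x, ∃ i, P i x) :
    Dense (AddSubmonoid.closure (⋃ i, Set.range (inclCrossed hα (P i))) :
      Set (α.quasiAction hα).CrossedProduct) := by
  intro x
  change x ∈ (AddSubmonoid.closure (⋃ i, Set.range (inclCrossed hα (P i)))).topologicalClosure
  induction x using QuasiAction.CrossedProduct.induction with
  | hc => exact AddSubmonoid.isClosed_topologicalClosure _
  | h0 => exact zero_mem _
  | ha x y hx hy => exact add_mem hx hy
  | hm t a h =>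
    obtain ⟨i, hi⟩ := hcover t.left
    exact AddSubmonoid.le_topologicalClosure _ (AddSubmonoid.subset_closure
      (Set.mem_iUnion.2 ⟨i, monomial_mem_range_inclCrossed hα (P i) (hP i) t hi a h⟩))

/-- The crossed product decomposes along each partition of the units of `G` into invariant sets. -/
theorem nonempty_starAlgEquiv_c0Sum_of_partition (hα : α.IsRegular) {I : Type u}
    (P : I → ObjectProperty G) (hP : ∀ i (t : Arrow G), P i t.left ↔ P i t.right)
    (hcover : ∀ x, ∃ i, P i x) (hdisj : ∀ i j, i ≠ j → ∀ x, P i x → ¬P j x) :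
    Nonempty ((α.quasiAction hα).CrossedProduct ≃⋆ₐ[ℂ]
      c0Sum fun i => ((α.restrict (P i)).quasiAction (hα.restrict (P i))).CrossedProduct) :=
  nonempty_starAlgEquiv_c0Sum (fun i => restrictCrossed hα (P i) (hP i))
    (fun i => inclCrossed hα (P i)) (fun i => restrictCrossed_inclCrossed hα (P i) (hP i))
    (fun i j hij => restrictCrossed_inclCrossed_of_disjoint hα (P i) (P j) (hP j) (hdisj i j hij))
    (fun i j hij => inclCrossed_mul_inclCrossed_of_disjoint hα (P i) (P j) (hdisj i j hij))
    (dense_closure_range_inclCrossed hα P hP hcover)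

end GroupoidAction

theorem GroupBundle.part_iff {G X : Type u} [Groupoid.{u} G] {R : Setoid X}
    {Γ : Quotient R → Type u} [∀ ξ, Group (Γ ξ)] (θ : Grpd.of G ≅ Grpd.of (GroupBundle R Γ))
    (ξ : Quotient R) (t : Arrow G) :
    GroupBundle.part θ ξ t.left ↔ GroupBundle.part θ ξ t.right := by
  let f : GroupBundle.Hom _ _ := (θ.hom : G ⥤ GroupBundle R Γ).map t.hom
  exact iff_of_eq (congrArg (· = ξ) (f.source_mem.trans f.target_mem.symm))

end

theorem mainTheorem2 {G H X : Type u} [Groupoid.{u} G] [Category.{u} H]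
    (α : GroupoidAction G H) (hα : α.IsRegular)
    (R : Setoid X) (Γ : Quotient R → Type u) [∀ ξ, Group (Γ ξ)]
    (θ : Grpd.of G ≅ Grpd.of (GroupBundle R Γ)) :
    Nonempty ((α.quasiAction hα).CrossedProduct ≃⋆ₐ[ℂ]
      c0Sum fun ξ : Quotient R =>
        ((α.restrict (GroupBundle.part θ ξ)).quasiAction
          (hα.restrict (GroupBundle.part θ ξ))).CrossedProduct) := by
  exact GroupoidAction.nonempty_starAlgEquiv_c0Sum_of_partition hα (GroupBundle.part θ)
    (GroupBundle.part_iff θ) (fun _ => ⟨_, rfl⟩)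
    fun _ _ hξη _ hx hx' => hξη (hx.symm.trans hx')
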